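/- Let $\mathcal F^2$ be the Fock space of entire functions $F:\mathbb C\to\mathbb C$ with $\|F\|^2=\int_{\mathbb C}|F(z)|^2e^{-\pi|z|^2}\,dA(z)<\infty$, where $dA$ is Lebesgue measure, let $P$ be the orthogonal projection of $L^2(\mathbb C,e^{-\pi|z|^2}dA)$ onto $\mathcal F^2$, and for a measurable set $\Omega\subset\mathbb C$ of finite positive area $|\Omega|$ let $T_\Omega=P\chi_\Omega:\mathcal F^2\to\mathcal F^2$ be the Toeplitz operator with symbol the characteristic function $\chi_\Omega$. It is compact, self-adjoint and positive; denote by $\lambda_1(\Omega)\ge\lambda_2(\Omega)\ge\cdots>0$ its eigenvalues in decreasing order, repeated according to multiplicity. Call $\Omega$ circularly symmetric if for some $w\in\mathbb C$ and some measurable set $E\subset[0,\infty)$ one has $\Omega=\{z\in\mathbb C:\ |z-w|\in E\}$. Let $\Omega\subset\mathbb C$ be a circularly symmetric set with $0<|\Omega|<\infty$, and let $\Omega^*$ be a disc with $|\Omega^*|=|\Omega|$. If $n\ge 2$ and $t_1\ge t_2\ge\cdots\ge t_n>0$ are real numbers, then $$\sum_{k=1}^n t_k\lambda_k(\Omega)\le\sum_{k=1}^n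 t_k\lambda_k(\Omega^*),$$ and equality holds if and only if $\Omega$ coincides with a translate of $\Omega^*$ up to a set of measure zero, that is, $|\Omega\,\triangle\,(\Omega^*+w)|=0$ for some $w\in\mathbb C$. -/

import Mathlib

open MeasureTheory Set Filter Topology
open scoped ENNReal

noncomputable section

namespace FockSpace

/-- The measure `e^{-π|z|²} dA(z)` on the complex plane. -/
def gaussianMeasure : Measure ℂ :=
  volume.withDensity fun z : ℂ => ENNReal.ofReal (Real.exp (-Real.pi * ‖z‖ ^ 2))

/-- The Fock space, as a subspace of `L²(ℂ, e^{-π|z|²} dA)`: the classes of the entire functions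
that are square integrable for the Gaussian measure. -/
def fock : Submodule ℂ (Lp ℂ 2 gaussianMeasure) where
  carrier := {f | ∃ F : ℂ → ℂ, Differentiable ℂ F ∧ f =ᵐ[gaussianMeasure] F}
  zero_mem' := ⟨fun _ => 0, differentiable_const 0, Lp.coeFn_zero ℂ 2 gaussianMeasure⟩
  add_mem' := by
    rintro f g ⟨F, hF, hfF⟩ ⟨G, hG, hgG⟩
    exact ⟨F + G, hF.add hG, (Lp.coeFn_add f g).trans (hfF.add hgG)⟩
  smul_mem' := by
    rintro c f ⟨F, hF, hfF⟩
    exact ⟨c • F, hF.const_smul c, (Lp.coeFn_smul c f).trans (hfF.const_smul c)⟩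

/-- Mean value inequality on a circle. -/
theorem circle_bound {F : ℂ → ℂ} (hF : Differentiable ℂ F) (z : ℂ) (r : ℝ) :
    ENNReal.ofReal (2 * Real.pi) * ‖F z‖ₑ ^ 2 ≤
      ∫⁻ θ in Ioo (-Real.pi) Real.pi, ‖F (circleMap z r θ)‖ₑ ^ 2 := by
  have h1 : Real.circleAverage (fun w => F w ^ 2) z r = F z ^ 2 :=
    (hF.pow 2).diffContOnCl.circleAverage
  rw [Real.circleAverage_def] at h1
  have hper : Function.Periodic (fun θ : ℝ => F (circleMap z r θ) ^ 2) (2 * Real.pi) := by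
    intro θ; simp only [periodic_circleMap z r θ]
  have h2 := hper.intervalIntegral_add_eq 0 (-Real.pi)
  have h3 : -Real.pi + 2 * Real.pi = Real.pi := by ring
  rw [h3, zero_add] at h2
  have hp : (0 : ℝ) < 2 * Real.pi := by positivity
  rw [h2, intervalIntegral.integral_of_le (by linarith [Real.pi_pos]), integral_Ioc_eq_integral_Ioo,
    inv_smul_eq_iff₀ hp.ne'] at h1
  have h4 := enorm_integral_le_lintegral_enorm (μ := volume.restrict (Ioo (-Real.pi) Real.pi))
    (fun θ : ℝ => F (circleMap z r θ) ^ 2)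
  rw [h1] at h4
  simpa only [enorm_smul, enorm_pow, Real.enorm_of_nonneg hp.le] using h4

/-- Mean value inequality on a disc of radius one. -/
theorem area_bound {F : ℂ → ℂ} (hF : Differentiable ℂ F) (z : ℂ) :
    ENNReal.ofReal (Real.pi / 2) * ‖F z‖ₑ ^ 2 ≤ ∫⁻ w in Metric.ball z 1, ‖F w‖ₑ ^ 2 := by
  have hFc := hF.continuous
  have e1 : ∫⁻ w in Metric.ball z 1, ‖F w‖ₑ ^ 2 =
      ∫⁻ w, (Metric.ball (0 : ℂ) 1).indicator (fun w => ‖F (z + w)‖ₑ ^ 2) w := by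
    rw [← lintegral_indicator measurableSet_ball, ← lintegral_add_left_eq_self _ z]
    congr 1 with w
    simp [indicator]
  rw [e1, ← Complex.lintegral_comp_polarCoord_symm]
  have hsub : Ioo (1 / 2 : ℝ) 1 ×ˢ Ioo (-Real.pi) Real.pi ⊆ polarCoord.target := by
    rintro ⟨r, θ⟩ ⟨h1, h2⟩
    exact ⟨lt_trans (by norm_num) h1.1, h2⟩
  refine le_trans ?_ (lintegral_mono_set hsub)
  have e2 : ∫⁻ p in Ioo (1 / 2 : ℝ) 1 ×ˢ Ioo (-Real.pi) Real.pi,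
      ENNReal.ofReal (1 / 2) * ‖F (circleMap z p.1 p.2)‖ₑ ^ 2 ≤
      ∫⁻ p in Ioo (1 / 2 : ℝ) 1 ×ˢ Ioo (-Real.pi) Real.pi, ENNReal.ofReal p.1 •
        (Metric.ball (0 : ℂ) 1).indicator (fun w => ‖F (z + w)‖ₑ ^ 2)
          (Complex.polarCoord.symm p) := by
    refine setLIntegral_mono' (measurableSet_Ioo.prod measurableSet_Ioo) ?_
    rintro ⟨r, θ⟩ ⟨⟨h1, h1'⟩, h2⟩
    have h0 : (0 : ℝ) < r := lt_trans (by norm_num) h1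
    have e3 : Complex.polarCoord.symm (r, θ) = r * Complex.exp (θ * Complex.I) := by
      rw [Complex.polarCoord_symm_apply, Complex.exp_mul_I]; push_cast; ring_nf
    have hm : (Complex.polarCoord.symm (r, θ)) ∈ Metric.ball (0 : ℂ) 1 := by
      rw [e3, mem_ball_zero_iff, norm_mul, Complex.norm_exp_ofReal_mul_I, mul_one,
        Complex.norm_real, Real.norm_of_nonneg h0.le]
      exact h1'
    rw [indicator_of_mem hm, e3, smul_eq_mul]
    simp only [circleMap]
    gcongr
  refine le_trans ?_ e2
  rw [Measure.volume_eq_prod, ← Measure.prod_restrict, lintegral_prod _ (by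
    refine Continuous.aemeasurable ?_
    simp only [circleMap]
    refine (ENNReal.continuous_const_mul (by simp)).comp ?_
    fun_prop)]
  calc ENNReal.ofReal (Real.pi / 2) * ‖F z‖ₑ ^ 2
      = ∫⁻ _ in Ioo (1 / 2 : ℝ) 1,
          ENNReal.ofReal (1 / 2) * (ENNReal.ofReal (2 * Real.pi) * ‖F z‖ₑ ^ 2) := by
        rw [setLIntegral_const, Real.volume_Ioo, ← mul_assoc, mul_right_comm,
          ← ENNReal.ofReal_mul (by norm_num), ← ENNReal.ofReal_mul (by positivity)]
        congr 2; ring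
    _ ≤ _ := by
        refine lintegral_mono fun r => ?_
        dsimp only
        rw [lintegral_const_mul' _ _ (by simp)]
        gcongr
        exact circle_bound hF z r

/-- Point evaluations are locally uniformly bounded by the norm of the Fock space. -/
theorem point_bound {F : ℂ → ℂ} (hF : Differentiable ℂ F) (z : ℂ) :
    ENNReal.ofReal (Real.exp (-Real.pi * (‖z‖ + 1) ^ 2)) * ‖F z‖ₑ ^ 2 ≤
      eLpNorm F 2 gaussianMeasure ^ 2 := by
  have hFc := hF.continuous
  have h1 : eLpNorm F 2 gaussianMeasure ^ 2 = ∫⁻ w, ‖F w‖ₑ ^ 2 ∂gaussianMeasure := by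
    have := eLpNorm_nnreal_pow_eq_lintegral (f := F) (μ := gaussianMeasure)
      (p := (2 : NNReal)) (by norm_num)
    simpa using this
  rw [h1, gaussianMeasure, lintegral_withDensity_eq_lintegral_mul _ (by fun_prop) (by fun_prop)]
  refine le_trans ?_ (setLIntegral_le_lintegral (Metric.ball z 1) _)
  calc _ ≤ ENNReal.ofReal (Real.exp (-Real.pi * (‖z‖ + 1) ^ 2)) *
          ∫⁻ w in Metric.ball z 1, ‖F w‖ₑ ^ 2 := by
        gcongr
        refine le_trans ?_ (area_bound hF z)
        refine le_mul_of_one_le_left' ?_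
        rw [ENNReal.one_le_ofReal]
        linarith [Real.pi_gt_three]
    _ = ∫⁻ w in Metric.ball z 1,
          ENNReal.ofReal (Real.exp (-Real.pi * (‖z‖ + 1) ^ 2)) * ‖F w‖ₑ ^ 2 := by
        rw [lintegral_const_mul' _ _ (by simp)]
    _ ≤ _ := by
        refine setLIntegral_mono' measurableSet_ball fun w hw => ?_
        simp only [Pi.mul_apply]
        gcongr ENNReal.ofReal (Real.exp ?_) * _
        have h2 : ‖w‖ ≤ ‖z‖ + 1 := by
          have h3 := norm_add_le z (w - z)
          rw [mem_ball_iff_norm] at hw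
          rw [add_sub_cancel] at h3
          linarith
        have h4 : ‖w‖ ^ 2 ≤ (‖z‖ + 1) ^ 2 := by gcongr
        nlinarith [Real.pi_pos]

/-- The Fock space is closed in `L²`, so that the orthogonal projection onto it exists. -/
theorem isClosed_fock : IsClosed (fock : Set (Lp ℂ 2 gaussianMeasure)) := by
  refine isClosed_of_closure_subset fun f hf => ?_
  obtain ⟨u, hu, hlim⟩ := mem_closure_iff_seq_limit.1 hf
  choose F hF hFu using hu
  -- Pointwise control of differences
  have key : ∀ (z : ℂ) (n m : ℕ),
      ‖F n z - F m z‖ ≤ Real.exp (Real.pi * (‖z‖ + 1) ^ 2) * dist (u n) (u m) := by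
    intro z n m
    have h1 := point_bound ((hF n).sub (hF m)) z
    have h2 : eLpNorm (F n - F m) 2 gaussianMeasure = edist (u n) (u m) := by
      rw [Lp.edist_def]
      exact eLpNorm_congr_ae ((hFu n).sub (hFu m)).symm
    rw [h2, edist_dist, ← ofReal_norm, ← ENNReal.ofReal_pow (norm_nonneg _),
      ← ENNReal.ofReal_pow dist_nonneg, ← ENNReal.ofReal_mul (Real.exp_pos _).le,
      ENNReal.ofReal_le_ofReal_iff (by positivity)] at h1
    set A := Real.pi * (‖z‖ + 1) ^ 2 with hA
    have hA0 : 0 ≤ A := by positivity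
    have hE : Real.exp A * Real.exp (-A) = 1 := by rw [← Real.exp_add]; simp
    have h1e : 1 ≤ Real.exp A := Real.one_le_exp hA0
    rw [neg_mul, ← hA] at h1
    refine abs_le_of_sq_le_sq' ?_ (by positivity) |>.2
    have h5 : ‖F n z - F m z‖ ^ 2 ≤ Real.exp A * dist (u n) (u m) ^ 2 := by
      calc ‖F n z - F m z‖ ^ 2 = Real.exp A * (Real.exp (-A) * ‖F n z - F m z‖ ^ 2) := by
            rw [← mul_assoc, hE, one_mul]
        _ ≤ _ := by gcongr; exact h1
    refine h5.trans ?_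
    rw [mul_pow]
    gcongr
    nlinarith
  have hcau : CauchySeq u := hlim.cauchySeq
  have huc : ∀ R : ℝ, UniformCauchySeqOn F atTop (Metric.ball 0 R) := by
    intro R
    rw [Metric.uniformCauchySeqOn_iff]
    intro ε hε
    set K := Real.exp (Real.pi * (|R| + 1) ^ 2)
    have hK : 0 < K := Real.exp_pos _
    obtain ⟨N, hN⟩ := Metric.cauchySeq_iff.1 hcau (ε / K) (by positivity)
    refine ⟨N, fun m hm n hn z hz => ?_⟩
    rw [dist_eq_norm]
    have hzR : ‖z‖ ≤ |R| := (mem_ball_zero_iff.1 hz).le.trans (le_abs_self R)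
    calc _ ≤ _ := key z m n
      _ ≤ K * dist (u m) (u n) := by
        refine mul_le_mul_of_nonneg_right (Real.exp_le_exp.2 ?_) dist_nonneg
        gcongr
      _ < K * (ε / K) := by gcongr; exact hN m hm n hn
      _ = ε := by field_simp
  have hpt : ∀ z, ∃ l, Tendsto (fun n => F n z) atTop (𝓝 l) := fun z =>
    cauchySeq_tendsto_of_complete ((huc (‖z‖ + 1)).cauchySeq (by simp))
  choose G hG using hpt
  have hGd : Differentiable ℂ G := by
    intro z
    have h1 : TendstoUniformlyOn F G atTop (Metric.ball 0 (‖z‖ + 1)) :=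
      (huc _).tendstoUniformlyOn_of_tendsto fun w _ => hG w
    exact (h1.tendstoLocallyUniformlyOn.differentiableOn
      (Eventually.of_forall fun n => (hF n).differentiableOn) Metric.isOpen_ball).differentiableAt
      (Metric.isOpen_ball.mem_nhds (by simp))
  obtain ⟨φ, hφ, hae⟩ := (tendstoInMeasure_of_tendsto_Lp hlim).exists_seq_tendsto_ae
  refine ⟨G, hGd, ?_⟩
  filter_upwards [hae, ae_all_iff.2 hFu] with z hz hz'
  refine tendsto_nhds_unique hz ?_
  simp only [hz']
  exact (hG z).comp hφ.tendsto_atTop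

instance : CompleteSpace fock := isClosed_fock.completeSpace_coe

/-- A (Lebesgue) measurable subset of the plane is measurable for the Gaussian measure. -/
theorem nullMeasurableSet_gaussian {Ω : Set ℂ} (hΩ : NullMeasurableSet Ω volume) :
    NullMeasurableSet Ω gaussianMeasure :=
  hΩ.mono_ac (withDensity_absolutelyContinuous _ _)

/-- Cutting off a square integrable function to a measurable set. -/
theorem memLp_indicator_aux {Ω : Set ℂ} (hΩ : NullMeasurableSet Ω volume)
    (f : Lp ℂ 2 gaussianMeasure) : MemLp (Ω.indicator f) 2 gaussianMeasure :=
  MemLp.of_le (Lp.memLp f)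
    ((Lp.aestronglyMeasurable f).indicator₀ (nullMeasurableSet_gaussian hΩ))
    (Eventually.of_forall fun _ => norm_indicator_le_norm_self _ _)

/-- Multiplication by the characteristic function of the measurable set `Ω`, as a bounded operator
on `L²(ℂ, e^{-π|z|²} dA)`. -/
def mulIndicator (Ω : Set ℂ) (hΩ : NullMeasurableSet Ω volume) :
    Lp ℂ 2 gaussianMeasure →L[ℂ] Lp ℂ 2 gaussianMeasure :=
  LinearMap.mkContinuous
    { toFun := fun f =>
        MemLp.toLp (Ω.indicator f) (memLp_indicator_aux hΩ f)
      map_add' := fun f g => by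
        rw [← MemLp.toLp_add, MemLp.toLp_eq_toLp_iff, ← indicator_add']
        filter_upwards [Lp.coeFn_add f g] with z hz
        simp only [indicator, hz]
      map_smul' := fun c f => by
        rw [RingHom.id_apply, ← MemLp.toLp_const_smul, MemLp.toLp_eq_toLp_iff]
        filter_upwards [Lp.coeFn_smul c f] with z hz
        by_cases h : z ∈ Ω <;> simp [h, hz] }
    1 (fun f => by
      rw [one_mul]
      refine Lp.norm_le_norm_of_ae_le ?_
      filter_upwards [MemLp.coeFn_toLp (memLp_indicator_aux hΩ f)] with z hz
      refine (le_of_eq (congrArg norm hz)).trans ?_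
      exact norm_indicator_le_norm_self _ _)

/-- The Toeplitz operator `T_Ω = P χ_Ω : 𝓕² → 𝓕²`, where `P` is the orthogonal projection of
`L²(ℂ, e^{-π|z|²} dA)` onto the Fock space `𝓕²`. -/
def toeplitz (Ω : Set ℂ) (hΩ : NullMeasurableSet Ω volume) : fock →L[ℂ] fock :=
  fock.orthogonalProjectionOnto ∘L mulIndicator Ω hΩ ∘L fock.subtypeL

/-- The `k`-th real eigenvalue of an operator (`k ≥ 1`), the eigenvalues being listed in
decreasing order and repeated according to multiplicity: the largest eigenvalue `μ` such that
there are at least `k` eigenvalues `ν ≥ μ`, counted with multiplicity (that is, the eigenspaces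
of the eigenvalues `ν ≥ μ` together span a space of dimension at least `k`). -/
def nthEigenvalue {E : Type*} [NormedAddCommGroup E] [NormedSpace ℂ E] (T : E →L[ℂ] E) (k : ℕ) :
    ℝ :=
  sSup {μ : ℝ | Module.End.HasEigenvalue (T : Module.End ℂ E) (μ : ℂ) ∧
    (k : Cardinal) ≤ Module.rank ℂ
      (⨆ ν : ℝ, ⨆ _ : μ ≤ ν, Module.End.eigenspace (T : Module.End ℂ E) (ν : ℂ) : Submodule ℂ E)}

/-- `eigenvalue Ω hΩ k` is `λ_k(Ω)`, the `k`-th largest eigenvalue (`k ≥ 1`) of the Toeplitz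
operator `T_Ω`; this operator is self-adjoint, so that all of its eigenvalues are real. -/
def eigenvalue (Ω : Set ℂ) (hΩ : NullMeasurableSet Ω volume) (k : ℕ) : ℝ :=
  nthEigenvalue (toeplitz Ω hΩ) k

/-- A set is circularly symmetric if, up to a translation by some `w`, it is the set of all `z`
with `|z| ∈ E`, for a measurable set `E` of the half-line `[0, ∞)`. -/
def IsCircularlySymmetric (Ω : Set ℂ) : Prop :=
  ∃ (w : ℂ) (E : Set ℝ), NullMeasurableSet E volume ∧ E ⊆ Ici 0 ∧ Ω = {z : ℂ | ‖z - w‖ ∈ E}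

/-- Two subsets of the plane are equivalent if their symmetric difference has measure zero. -/
def Equivalent (Ω Ω' : Set ℂ) : Prop :=
  volume (symmDiff Ω Ω') = 0

end FockSpace

end

noncomputable section

namespace FockSpace

/-! Put $p_j(s)=s^je^{-s}/j!$. With the substitution $s=\pi|z-w|^2$, the Toeplitz operator of a
radial set is diagonal in the monomials centred at $w$, with eigenvalues $\int_S p_j$
(`isDiagonal_toeplitz`). For a disc of area $a$ one has $S=(0,a)$, and the eigenvalues `poissonTail
j a` already decrease in $j$. For a general radial set the order of the indices is unknown, but the
$n$ largest eigenvalues belong to some set $K$ of $n$ indices, so it suffices to bound $\sum_{k\in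
K}\int_S p_k$ for every finite $K$ (`sum_integral_poissonWeight_le`).

That bound has a probabilistic reading. The density of arrival number $k$, counted from $0$, of a
unit-rate Poisson process is $p_k$, so the sum is the expected number of arrivals with index in $K$
at times in $S$. If $k$ arrivals have occurred, $r$ indices of $K$ are at least $k$, and $S$ has
measure $\alpha$ left, the claimed bound on the future gain is $E\min(r,N(\alpha))$ with $N(\alpha)$
Poisson of mean $\alpha$, which is `tailSum r α`. The `potential` is the gain expected up to time
$s$ plus this bound averaged over $k$. It starts at `tailSum K.card a` and tends to the sum in
question. Its derivative `potentialDeriv` is nonpositive: there is a loss when a time outside $S$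
passes while the next index is in $K$, and when a time in $S$ is spent while the next index is not.
In the case of equality the first loss must vanish, so almost no time outside $S$ can pass before
$S$ is used up, and $S$ is $(0,a]$ up to a null set.

Summation by parts (`mul_sum_le_sum_mul`) bounds the weighted difference below by $t_n$ times the
difference of the unweighted sums, which gives both the inequality and its equality case. -/

/-! ### Poisson weights and their primitives -/

/-- The Poisson weight `s^k e^{-s} / k!`. -/
def poissonWeight (k : ℕ) (s : ℝ) : ℝ := s ^ k * Real.exp (-s) / k.factorial

/-- The primitive `∫₀ᵃ s^k e^{-s} / k! ds` of the Poisson weight, in closed form. -/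
def poissonTail (k : ℕ) (a : ℝ) : ℝ := 1 - ∑ l ∈ Finset.range (k + 1), poissonWeight l a

theorem poissonWeight_nonneg (k : ℕ) {s : ℝ} (hs : 0 ≤ s) : 0 ≤ poissonWeight k s := by
  unfold poissonWeight; positivity

theorem poissonWeight_pos (k : ℕ) {s : ℝ} (hs : 0 < s) : 0 < poissonWeight k s := by
  unfold poissonWeight; positivity

theorem contDiff_poissonWeight (k : ℕ) : ContDiff ℝ 1 (poissonWeight k) := by
  unfold poissonWeight; fun_prop

theorem continuous_poissonWeight (k : ℕ) : Continuous (poissonWeight k) :=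
  (contDiff_poissonWeight k).continuous

theorem contDiff_poissonTail (k : ℕ) : ContDiff ℝ 1 (poissonTail k) := by
  unfold poissonTail
  exact contDiff_const.sub (ContDiff.sum fun i _ => contDiff_poissonWeight i)

theorem poissonWeight_zero_apply (s : ℝ) : poissonWeight 0 s = Real.exp (-s) := by
  simp [poissonWeight]

theorem poissonWeight_apply_zero (k : ℕ) : poissonWeight k 0 = if k = 0 then 1 else 0 := by
  cases k <;> simp [poissonWeight]

theorem hasDerivAt_poissonWeight_zero (s : ℝ) :
    HasDerivAt (poissonWeight 0) (-poissonWeight 0 s) s := by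
  have h : poissonWeight 0 = fun s => Real.exp (-s) := funext poissonWeight_zero_apply
  rw [h]
  simpa using (hasDerivAt_neg s).exp

theorem hasDerivAt_poissonWeight_succ (k : ℕ) (s : ℝ) :
    HasDerivAt (poissonWeight (k + 1)) (poissonWeight k s - poissonWeight (k + 1) s) s := by
  have h := ((hasDerivAt_pow (k + 1) s).mul (hasDerivAt_neg s).exp).div_const
    ((k + 1).factorial : ℝ)
  refine h.congr_deriv ?_
  have : (k.factorial : ℝ) ≠ 0 := by positivity
  simp only [poissonWeight, Nat.factorial_succ, Nat.cast_mul, add_tsub_cancel_right]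
  push_cast
  field_simp
  ring

/-- The relation $p_k'=p_{k-1}-p_k$ makes the derivative of the finite sum telescope. -/
theorem hasDerivAt_poissonTail (k : ℕ) (s : ℝ) :
    HasDerivAt (poissonTail k) (poissonWeight k s) s := by
  induction k with
  | zero =>
    have h := (hasDerivAt_poissonWeight_zero s).const_sub 1
    have e : poissonTail 0 = fun a => 1 - poissonWeight 0 a := by
      funext a
      simp [poissonTail]
    rw [e]
    exact h.congr_deriv (neg_neg _)
  | succ k ih =>
    have h := ih.sub (hasDerivAt_poissonWeight_succ k s)
    have e : poissonTail (k + 1) = poissonTail k - poissonWeight (k + 1) := by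
      funext a
      simp only [poissonTail, Pi.sub_apply, Finset.sum_range_succ _ (k + 1)]
      ring
    rw [e]
    exact h.congr_deriv (by ring)

theorem poissonTail_zero (k : ℕ) : poissonTail k 0 = 0 := by
  simp [poissonTail, poissonWeight_apply_zero]

theorem intervalIntegral_poissonWeight (k : ℕ) (a : ℝ) :
    ∫ s in (0 : ℝ)..a, poissonWeight k s = poissonTail k a := by
  rw [intervalIntegral.integral_eq_sub_of_hasDerivAt (fun x _ => hasDerivAt_poissonTail k x)
    ((continuous_poissonWeight k).intervalIntegrable _ _), poissonTail_zero, sub_zero]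

theorem poissonTail_nonneg (k : ℕ) {a : ℝ} (ha : 0 ≤ a) : 0 ≤ poissonTail k a := by
  rw [← intervalIntegral_poissonWeight]
  exact intervalIntegral.integral_nonneg ha fun s hs => poissonWeight_nonneg k hs.1

theorem poissonTail_pos (k : ℕ) {a : ℝ} (ha : 0 < a) : 0 < poissonTail k a := by
  rw [← intervalIntegral_poissonWeight]
  exact intervalIntegral.intervalIntegral_pos_of_pos_on
    ((continuous_poissonWeight k).intervalIntegrable _ _)
    (fun s hs => poissonWeight_pos k hs.1) ha

/-- Consecutive terms differ by a Poisson weight. Hence the eigenvalues of a disc are listed in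
decreasing order by degree. -/
theorem poissonTail_antitone {a : ℝ} (ha : 0 ≤ a) : Antitone fun k => poissonTail k a := by
  refine antitone_nat_of_succ_le fun k => ?_
  have := poissonWeight_nonneg (k + 1) ha
  simp only [poissonTail, Finset.sum_range_succ _ (k + 1)]
  linarith

theorem poissonWeight_le_one (k : ℕ) {s : ℝ} (hs : 0 ≤ s) : poissonWeight k s ≤ 1 := by
  unfold poissonWeight
  rw [mul_div_right_comm, Real.exp_neg, ← div_eq_mul_inv, div_le_one (Real.exp_pos s)]
  exact Real.pow_div_factorial_le_exp s hs k

theorem tendsto_poissonWeight_index (s : ℝ) :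
    Tendsto (fun k => poissonWeight k s) atTop (𝓝 0) := by
  have h := (FloorSemiring.tendsto_pow_div_factorial_atTop s).mul_const (Real.exp (-s))
  rw [zero_mul] at h
  refine h.congr fun k => ?_
  simp only [poissonWeight]
  ring

theorem tendsto_poissonWeight_atTop (k : ℕ) :
    Tendsto (poissonWeight k) atTop (𝓝 0) := by
  have h := (Real.tendsto_pow_mul_exp_neg_atTop_nhds_zero k).div_const (k.factorial : ℝ)
  rw [zero_div] at h
  exact h

/-- The sum of the first `n` primitives; it is the sum of the `n` largest eigenvalues of the disc
of area `a`. -/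
def tailSum (n : ℕ) (a : ℝ) : ℝ := ∑ i ∈ Finset.range n, poissonTail i a

theorem hasDerivAt_tailSum (n : ℕ) (a : ℝ) :
    HasDerivAt (tailSum n) (∑ i ∈ Finset.range n, poissonWeight i a) a := by
  have := HasDerivAt.fun_sum (u := Finset.range n) fun i _ => hasDerivAt_poissonTail i a
  exact this

theorem contDiff_tailSum (n : ℕ) : ContDiff ℝ 1 (tailSum n) := by
  unfold tailSum
  exact ContDiff.sum fun i _ => contDiff_poissonTail i

/-! ### The monotone potential and the comparison with an interval -/

/-- A continuously differentiable function of `s` and of a Lipschitz function of `s` is absolutely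
continuous. -/
theorem absolutelyContinuous_of_contDiff_lipschitz {Φ : ℝ × ℝ → ℝ} (hΦ : ContDiff ℝ 1 Φ)
    {A : ℝ → ℝ} {C : NNReal} (hA : LipschitzWith C A) (x y : ℝ) :
    AbsolutelyContinuousOnInterval (fun s => Φ (s, A s)) x y := by
  have hG : LipschitzWith (max 1 C) fun s => (s, A s) := LipschitzWith.id.prodMk hA
  -- The curve $s\mapsto(s,A(s))$ stays in a ball over the compact interval, and a $C^1$ function is
  -- Lipschitz on that ball.
  obtain ⟨R, hR⟩ := (isCompact_uIcc.image hG.continuous (s := uIcc x y)).isBounded.subset_closedBall 0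
  obtain ⟨D, hD⟩ := hΦ.contDiffOn.exists_lipschitzOnWith (by decide) (convex_closedBall 0 R)
    (isCompact_closedBall 0 R)
  refine LipschitzOnWith.absolutelyContinuousOnInterval (K := D * max 1 C) ?_
  exact hD.comp hG.lipschitzOnWith fun s hs =>
    hR (mem_image_of_mem (fun s => (s, A s)) hs)

section Comparison

variable (S : Set ℝ)

/-- The measure of `S ∩ (0, s]`, as an interval integral. -/
def usedMeasure (s : ℝ) : ℝ := ∫ u in (0 : ℝ)..s, S.indicator 1 u

/-- The number of elements of `K` that are at least `k`. -/
def remaining (K : Finset ℕ) (k : ℕ) : ℕ := (K.filter (k ≤ ·)).card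

/-- The potential whose monotonicity proves the comparison with the disc. -/
def potential (K : Finset ℕ) (N : ℕ) (a : ℝ) (s : ℝ) : ℝ :=
  ∑ k ∈ Finset.range N, poissonWeight k s * tailSum (remaining K k) (a - usedMeasure S s) +
    ∫ u in (0 : ℝ)..s, S.indicator (fun v => ∑ k ∈ K, poissonWeight k v) u

/-- The derivative of the potential. -/
def potentialDeriv (K : Finset ℕ) (N : ℕ) (a : ℝ) (s : ℝ) : ℝ :=
  ∑ k ∈ Finset.range N, poissonWeight k s *
    if k ∈ K then
      -poissonTail (remaining K (k + 1)) (a - usedMeasure S s) * (1 - S.indicator 1 s)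
    else -S.indicator 1 s * ∑ i ∈ Finset.range (remaining K k),
      poissonWeight i (a - usedMeasure S s)

theorem remaining_of_mem {K : Finset ℕ} {k : ℕ} (hk : k ∈ K) :
    remaining K k = remaining K (k + 1) + 1 := by
  unfold remaining
  have : K.filter (k ≤ ·) = insert k (K.filter (k + 1 ≤ ·)) := by
    ext i
    simp only [Finset.mem_filter, Finset.mem_insert]
    grind
  rw [this, Finset.card_insert_of_notMem (by simp)]

theorem remaining_of_notMem {K : Finset ℕ} {k : ℕ} (hk : k ∉ K) :
    remaining K k = remaining K (k + 1) := by
  unfold remaining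
  congr 1
  ext i
  simp only [Finset.mem_filter]
  grind

theorem remaining_eq_zero {K : Finset ℕ} {N : ℕ} (hN : K ⊆ Finset.range N) :
    remaining K N = 0 := by
  unfold remaining
  rw [Finset.card_eq_zero, Finset.filter_eq_empty_iff]
  intro i hi
  have := Finset.mem_range.1 (hN hi)
  omega

theorem remaining_zero (K : Finset ℕ) : remaining K 0 = K.card := by
  simp [remaining]

variable {S}

theorem locallyIntegrable_indicator_one (hS : MeasurableSet S) :
    LocallyIntegrable (S.indicator (1 : ℝ → ℝ)) volume :=
  (locallyIntegrable_const (1 : ℝ)).indicator hS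

theorem intervalIntegrable_indicator (hS : MeasurableSet S) {f : ℝ → ℝ} (hf : Continuous f)
    (x y : ℝ) : IntervalIntegrable (S.indicator f) volume x y := by
  rw [intervalIntegrable_iff]
  exact (hf.integrableOn_uIoc).indicator hS

theorem lipschitzWith_usedMeasure (hS : MeasurableSet S) : LipschitzWith 1 (usedMeasure S) := by
  refine LipschitzWith.of_dist_le_mul fun x y => ?_
  have hi : ∀ x y, IntervalIntegrable (S.indicator (1 : ℝ → ℝ)) volume x y :=
    fun x y => intervalIntegrable_indicator hS continuous_one x y
  rw [Real.dist_eq, usedMeasure, usedMeasure,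
    intervalIntegral.integral_interval_sub_left (hi _ _) (hi _ _)]
  have := intervalIntegral.norm_integral_le_of_norm_le_const (a := y) (b := x) (C := 1)
    (f := S.indicator (1 : ℝ → ℝ)) fun u _ => by
      by_cases h : u ∈ S <;> simp [h]
  simpa [Real.dist_eq] using this

/-- Since $S$ is only measurable, the potential is differentiable merely almost everywhere; absolute
continuity is what allows it to be recovered from its derivative. -/
theorem absolutelyContinuous_potential (hS : MeasurableSet S) (K : Finset ℕ) (N : ℕ) (a x y : ℝ) :
    AbsolutelyContinuousOnInterval (potential S K N a) x y := by
  have h1 : AbsolutelyContinuousOnInterval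
      (fun s => (fun q : ℝ × ℝ => ∑ k ∈ Finset.range N,
        poissonWeight k q.1 * tailSum (remaining K k) (a - q.2)) (s, usedMeasure S s)) x y := by
    refine absolutelyContinuous_of_contDiff_lipschitz
      (Φ := fun q : ℝ × ℝ => ∑ k ∈ Finset.range N,
        poissonWeight k q.1 * tailSum (remaining K k) (a - q.2))
      (ContDiff.sum fun k _ => ?_) (lipschitzWith_usedMeasure hS) x y
    exact ((contDiff_poissonWeight k).comp contDiff_fst).mul
      ((contDiff_tailSum _).comp (contDiff_const.sub contDiff_snd))
  have hc : Continuous fun v => ∑ k ∈ K, poissonWeight k v :=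
    continuous_finsetSum _ fun k _ => continuous_poissonWeight k
  have h2 := (intervalIntegrable_indicator hS hc x y)
    |>.absolutelyContinuousOnInterval_intervalIntegral (c := x) (by simp)
  have h3 : AbsolutelyContinuousOnInterval
      (fun _ : ℝ => ∫ u in (0 : ℝ)..x, S.indicator (fun v => ∑ k ∈ K, poissonWeight k v) u) x y :=
    (LipschitzWith.const _).lipschitzOnWith.absolutelyContinuousOnInterval
  have h4 := h1.add (h3.add h2)
  convert! h4 using 1
  funext s
  simp only [potential, Pi.add_apply]
  rw [intervalIntegral.integral_add_adjacent_intervals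
    (intervalIntegrable_indicator hS hc _ _) (intervalIntegrable_indicator hS hc _ _)]

/-- At the Lebesgue points supplied by the differentiation theorem this is the product rule,
followed by an index shift in the terms $p_{k-1}$ coming from $p_k'$. -/
theorem ae_hasDerivAt_potential (hS : MeasurableSet S) {K : Finset ℕ} {N : ℕ}
    (hN : K ⊆ Finset.range N) (a : ℝ) :
    ∀ᵐ s, HasDerivAt (potential S K N a) (potentialDeriv S K N a s) s := by
  have hc : Continuous fun v => ∑ k ∈ K, poissonWeight k v :=
    continuous_finsetSum _ fun k _ => continuous_poissonWeight k
  have hl : LocallyIntegrable (S.indicator fun v => ∑ k ∈ K, poissonWeight k v) volume :=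
    hc.locallyIntegrable.indicator hS
  filter_upwards [_root_.LocallyIntegrable.ae_hasDerivAt_integral
      (locallyIntegrable_indicator_one hS), _root_.LocallyIntegrable.ae_hasDerivAt_integral hl] with s h1 h2
  have hA : HasDerivAt (fun s => a - usedMeasure S s) (-S.indicator 1 s) s := (h1 0).const_sub a
  set α := a - usedMeasure S s with hα
  have hp : ∀ k, HasDerivAt (poissonWeight k)
      ((if k = 0 then 0 else poissonWeight (k - 1) s) - poissonWeight k s) s := by
    intro k
    cases k with
    | zero => simpa using hasDerivAt_poissonWeight_zero s
    | succ k => simpa using hasDerivAt_poissonWeight_succ k s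
  have h3 := (HasDerivAt.fun_sum (u := Finset.range N) fun k _ =>
    (hp k).mul ((hasDerivAt_tailSum (remaining K k) α).comp s hA)).add (h2 0)
  refine h3.congr_deriv ?_
  -- Neither end of the shift contributes: the term $k=0$ has coefficient $0$, and at $k=N$ no index
  -- of $K$ remains, so `tailSum` is an empty sum.
  have hshift : ∑ k ∈ Finset.range N,
      (if k = 0 then 0 else poissonWeight (k - 1) s) * tailSum (remaining K k) α =
      ∑ k ∈ Finset.range N, poissonWeight k s * tailSum (remaining K (k + 1)) α := by
    have e1 := Finset.sum_range_succ (fun k =>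
      (if k = 0 then 0 else poissonWeight (k - 1) s) * tailSum (remaining K k) α) N
    have e2 := Finset.sum_range_succ' (fun k =>
      (if k = 0 then 0 else poissonWeight (k - 1) s) * tailSum (remaining K k) α) N
    rw [e1, remaining_eq_zero hN] at e2
    simpa [tailSum] using e2
  have hK : S.indicator (fun v => ∑ k ∈ K, poissonWeight k v) s =
      ∑ k ∈ Finset.range N, poissonWeight k s * (if k ∈ K then S.indicator 1 s else 0) := by
    simp only [mul_ite, mul_zero]
    rw [← Finset.sum_filter, Finset.filter_mem_eq_inter, Finset.inter_eq_right.2 hN]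
    by_cases hs : s ∈ S <;> simp [hs]
  have hsplit : ∀ k, ((if k = 0 then 0 else poissonWeight (k - 1) s) - poissonWeight k s) *
      (tailSum (remaining K k) ∘ fun s => a - usedMeasure S s) s +
      poissonWeight k s * ((∑ i ∈ Finset.range (remaining K k), poissonWeight i α) *
        -S.indicator 1 s) =
      (if k = 0 then 0 else poissonWeight (k - 1) s) * tailSum (remaining K k) α +
      poissonWeight k s * (-tailSum (remaining K k) α - S.indicator 1 s *
        ∑ i ∈ Finset.range (remaining K k), poissonWeight i α) := by
    intro k
    simp only [Function.comp_apply, ← hα]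
    ring
  rw [Finset.sum_congr rfl fun k _ => hsplit k, Finset.sum_add_distrib, hshift, hK,
    ← Finset.sum_add_distrib, ← Finset.sum_add_distrib, potentialDeriv]
  refine Finset.sum_congr rfl fun k _ => ?_
  rw [← mul_add, ← mul_add]
  congr 1
  -- Write $r$ for `remaining K (k + 1)` and $Q_r$ for `poissonTail r`. If $k\in K$, the bracket is
  -- $-Q_r+1_S-1_S(1-Q_r)=-Q_r(1-1_S)$. If $k\notin K$, the two `tailSum` terms cancel.
  by_cases hk : k ∈ K
  · simp only [hk, if_true, remaining_of_mem hk, ← hα]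
    have e : tailSum (remaining K (k + 1) + 1) α =
        tailSum (remaining K (k + 1)) α + poissonTail (remaining K (k + 1)) α :=
      Finset.sum_range_succ _ _
    have e' : ∑ i ∈ Finset.range (remaining K (k + 1) + 1), poissonWeight i α =
        1 - poissonTail (remaining K (k + 1)) α := by
      simp [poissonTail]
    rw [e, e']
    ring
  · simp only [hk, if_false, remaining_of_notMem hk, ← hα]
    ring

theorem usedMeasure_eq (hS : MeasurableSet S) {s : ℝ} (hs : 0 ≤ s) :
    usedMeasure S s = volume.real (S ∩ Ioc 0 s) := by
  rw [usedMeasure, intervalIntegral.integral_of_le hs, integral_indicator hS,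
    Measure.restrict_restrict hS]
  simp

theorem potentialDeriv_nonpos (K : Finset ℕ) (N : ℕ) {a s : ℝ} (hs : 0 ≤ s)
    (ha : usedMeasure S s ≤ a) : potentialDeriv S K N a s ≤ 0 := by
  refine Finset.sum_nonpos fun k _ => mul_nonpos_of_nonneg_of_nonpos
    (poissonWeight_nonneg k hs) ?_
  have h0 : (0 : ℝ) ≤ S.indicator 1 s := indicator_nonneg (by simp) s
  have h1 : S.indicator 1 s ≤ (1 : ℝ) := indicator_le_self' (by simp) s
  split_ifs
  · rw [neg_mul, neg_nonpos]
    exact mul_nonneg (poissonTail_nonneg _ (sub_nonneg.2 ha)) (by linarith)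
  · rw [neg_mul, neg_nonpos]
    exact mul_nonneg h0 (Finset.sum_nonneg fun i _ => poissonWeight_nonneg i (sub_nonneg.2 ha))

/-- This is the source of rigidity: outside $S$, with measure of $S$ still unused, each index of $K$
contributes a strict loss. -/
theorem potentialDeriv_neg {K : Finset ℕ} {N k : ℕ} (hk : k ∈ K) (hN : K ⊆ Finset.range N)
    {a s : ℝ} (hs : 0 < s) (hsS : s ∉ S) (ha : usedMeasure S s < a) :
    potentialDeriv S K N a s < 0 := by
  refine Finset.sum_neg' (fun i _ => mul_nonpos_of_nonneg_of_nonpos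
    (poissonWeight_nonneg i hs.le) ?_) ⟨k, hN hk, mul_neg_of_pos_of_neg
    (poissonWeight_pos k hs) ?_⟩
  · simp only [indicator_of_notMem hsS]
    split_ifs
    · simpa using poissonTail_nonneg _ (sub_nonneg.2 ha.le)
    · simp
  · simpa [hk, indicator_of_notMem hsS] using poissonTail_pos (remaining K (k + 1)) (sub_pos.2 ha)

theorem potential_zero {K : Finset ℕ} {N : ℕ} (hN : K ⊆ Finset.range N) (a : ℝ) :
    potential S K N a 0 = tailSum K.card a := by
  cases N with
  | zero =>
    have : K = ∅ := by simpa using hN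
    subst this
    simp [potential, tailSum]
  | succ N =>
    rw [potential, Finset.sum_range_succ']
    simp [poissonWeight_apply_zero, usedMeasure, remaining_zero]

theorem potential_sub (hS : MeasurableSet S) {K : Finset ℕ} {N : ℕ} (hN : K ⊆ Finset.range N)
    (a : ℝ) {x y : ℝ} : ∫ s in x..y, potentialDeriv S K N a s =
      potential S K N a y - potential S K N a x := by
  rw [← (absolutelyContinuous_potential hS K N a x y).integral_deriv_eq_sub]
  refine intervalIntegral.integral_congr_ae ?_
  filter_upwards [ae_hasDerivAt_potential hS hN a] with s hs _
  exact hs.deriv.symm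

theorem intervalIntegrable_potentialDeriv (hS : MeasurableSet S) {K : Finset ℕ} {N : ℕ}
    (hN : K ⊆ Finset.range N) (a x y : ℝ) :
    IntervalIntegrable (potentialDeriv S K N a) volume x y := by
  refine (absolutelyContinuous_potential hS K N a x y).intervalIntegrable_deriv.congr_ae ?_
  refine ae_restrict_of_ae ?_
  filter_upwards [ae_hasDerivAt_potential hS hN a] with s hs
  exact hs.deriv

end Comparison

theorem integrableOn_poissonWeight (k : ℕ) {S : Set ℝ} (hS : MeasurableSet S) (hpos : S ⊆ Ioi 0)
    (hfin : volume S ≠ ∞) : IntegrableOn (poissonWeight k) S := by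
  refine Measure.integrableOn_of_bounded (M := 1) hfin
    (continuous_poissonWeight k).aestronglyMeasurable ?_
  filter_upwards [ae_restrict_mem hS] with s hs
  have : 0 ≤ s := le_of_lt (mem_Ioi.1 (hpos hs))
  rw [Real.norm_of_nonneg (poissonWeight_nonneg k this)]
  exact poissonWeight_le_one k this

/-- Among the sets `S` of given measure, the sum of the integrals of `n` distinct Poisson weights
is largest for the initial interval and the first `n` weights, and only for that interval. -/
theorem sum_integral_poissonWeight_le {S : Set ℝ} (hS : MeasurableSet S) (hpos : S ⊆ Ioi 0)
    (hfin : volume S ≠ ∞) (K : Finset ℕ) :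
    ∑ k ∈ K, ∫ s in S, poissonWeight k s ≤ tailSum K.card (volume.real S) ∧
    (K.Nonempty → ∑ k ∈ K, ∫ s in S, poissonWeight k s = tailSum K.card (volume.real S) →
      S =ᵐ[volume] Ioc 0 (volume.real S)) := by
  obtain ⟨N, hN⟩ := Finset.exists_nat_subset_range K
  set a := volume.real S with ha
  have hle : ∀ s, 0 ≤ s → usedMeasure S s ≤ a := fun s hs => by
    rw [usedMeasure_eq hS hs]
    exact measureReal_mono inter_subset_left hfin
  have hanti : ∀ x y, 0 ≤ x → x ≤ y → potential S K N a y ≤ potential S K N a x := by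
    intro x y hx hxy
    have h1 : 0 ≤ ∫ s in x..y, -potentialDeriv S K N a s :=
      intervalIntegral.integral_nonneg hxy fun s hs =>
        neg_nonneg.2 (potentialDeriv_nonpos K N (hx.trans hs.1) (hle s (hx.trans hs.1)))
    rw [intervalIntegral.integral_neg, potential_sub hS hN] at h1
    linarith
  have hint : IntegrableOn (fun v => ∑ k ∈ K, poissonWeight k v) S :=
    integrable_finsetSum _ fun k _ => integrableOn_poissonWeight k hS hpos hfin
  have hsum : ∑ k ∈ K, ∫ s in S, poissonWeight k s =
      ∫ s in Ioi 0, S.indicator (fun v => ∑ k ∈ K, poissonWeight k v) s := by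
    rw [← integral_finsetSum _ fun k _ => integrableOn_poissonWeight k hS hpos hfin,
      setIntegral_indicator hS, inter_eq_right.2 hpos]
  -- As $s\to\infty$ the weights vanish while the `tailSum` factors stay bounded, their arguments
  -- lying in $[0,a]$; only the integral survives.
  have hlim : Tendsto (potential S K N a) atTop (𝓝 (∑ k ∈ K, ∫ s in S, poissonWeight k s)) := by
    rw [hsum, ← zero_add (∫ s in Ioi 0, _)]
    refine Tendsto.add ?_ (intervalIntegral_tendsto_integral_Ioi 0
      (hint.integrable_indicator hS).integrableOn tendsto_id)
    rw [← Finset.sum_const_zero (s := Finset.range N)]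
    refine tendsto_finsetSum _ fun k _ => ?_
    obtain ⟨C, hC⟩ := isCompact_Icc.exists_bound_of_continuousOn
      (contDiff_tailSum (remaining K k)).continuous.continuousOn (s := Icc 0 a)
    refine Tendsto.zero_mul_isBoundedUnder_le (tendsto_poissonWeight_atTop k) ?_
    refine isBoundedUnder_of_eventually_le (a := C) ?_
    filter_upwards [eventually_ge_atTop 0] with s hs
    refine hC _ ⟨sub_nonneg.2 (hle s hs), ?_⟩
    rw [usedMeasure_eq hS hs]
    have : 0 ≤ volume.real (S ∩ Ioc 0 s) := measureReal_nonneg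
    linarith
  have hbound : ∀ x, 0 ≤ x → ∑ k ∈ K, ∫ s in S, poissonWeight k s ≤ potential S K N a x :=
    fun x hx => le_of_tendsto hlim <| by
      filter_upwards [eventually_ge_atTop x] with y hy using hanti x y hx hy
  have h0 := potential_zero (S := S) hN a
  refine ⟨h0 ▸ hbound 0 le_rfl, ?_⟩
  rintro ⟨k, hk⟩ heq
  have hconst : ∀ x, 0 ≤ x → potential S K N a x = potential S K N a 0 := fun x hx =>
    le_antisymm (hanti 0 x le_rfl hx) (by rw [h0, ← heq]; exact hbound x hx)
  -- A constant potential has zero derivative almost everywhere, so strict loss is excluded on each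
  -- $(0,n]$.
  have hae : ∀ᵐ s, 0 < s → s ∉ S → a ≤ usedMeasure S s := by
    have h1 : ∀ n : ℕ, ∀ᵐ s, s ∈ Ioc (0 : ℝ) n → potentialDeriv S K N a s = 0 := by
      intro n
      have h2 : ∫ s in (0 : ℝ)..n, -potentialDeriv S K N a s = 0 := by
        rw [intervalIntegral.integral_neg, potential_sub hS hN, hconst _ n.cast_nonneg]
        simp
      rw [← ae_restrict_iff' measurableSet_Ioc]
      have h3 := (intervalIntegral.integral_eq_zero_iff_of_nonneg_ae ?_
        (intervalIntegrable_potentialDeriv hS hN a 0 n).neg).1 h2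
      · rw [Ioc_eq_empty_of_le (n.cast_nonneg : (0 : ℝ) ≤ n), union_empty] at h3
        filter_upwards [h3] with s hs
        simpa using hs
      · rw [Ioc_eq_empty_of_le (n.cast_nonneg : (0 : ℝ) ≤ n), union_empty]
        filter_upwards [ae_restrict_mem measurableSet_Ioc] with s hs
        exact neg_nonneg.2 (potentialDeriv_nonpos K N hs.1.le (hle s hs.1.le))
    filter_upwards [ae_all_iff.2 h1] with s hs h0s hsS
    obtain ⟨n, hn⟩ := exists_nat_ge s
    by_contra! hlt
    exact (potentialDeriv_neg hk hN h0s hsS hlt).ne (hs n ⟨h0s, hn⟩)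
  have ha0 : 0 ≤ a := measureReal_nonneg
  -- Were $S$ not used up by time $a$, almost every point of $(0,a]$ would lie in $S$, which already
  -- has measure $a$.
  have hfull : usedMeasure S a = a := by
    refine (hle a ha0).antisymm ?_
    by_contra! hlt
    have h1 : Ioc 0 a ≤ᵐ[volume] (S ∩ Ioc 0 a : Set ℝ) := by
      filter_upwards [hae] with s hs hs'
      refine ⟨?_, hs'⟩
      by_contra hsS
      have h2 := hs hs'.1 hsS
      have h3 : usedMeasure S s ≤ usedMeasure S a := by
        rw [usedMeasure_eq hS ha0, usedMeasure_eq hS hs'.1.le]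
        exact measureReal_mono (inter_subset_inter_right _ (Ioc_subset_Ioc_right hs'.2))
          (measure_ne_top_of_subset inter_subset_left hfin)
      linarith
    have h4 := ENNReal.toReal_mono (measure_ne_top_of_subset inter_subset_left hfin)
      (measure_mono_ae h1)
    rw [usedMeasure_eq hS ha0] at hlt
    rw [Real.volume_Ioc, sub_zero, ENNReal.toReal_ofReal ha0] at h4
    exact absurd h4 (not_le.2 hlt)
  rw [usedMeasure_eq hS ha0] at hfull
  -- The intersection $S\cap(0,a]$ has the same finite measure $a$ as each of the two sets, hence
  -- agrees with both almost everywhere.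
  have e1 : (S ∩ Ioc 0 a : Set ℝ) =ᵐ[volume] S := by
    refine ae_eq_of_subset_of_measure_ge inter_subset_left ?_
      (hS.inter measurableSet_Ioc).nullMeasurableSet hfin
    rw [← ENNReal.toReal_le_toReal hfin (measure_ne_top_of_subset inter_subset_left hfin)]
    exact (hfull.ge : a ≤ _)
  have e2 : (S ∩ Ioc 0 a : Set ℝ) =ᵐ[volume] Ioc 0 a := by
    refine ae_eq_of_subset_of_measure_ge inter_subset_right ?_
      (hS.inter measurableSet_Ioc).nullMeasurableSet (by simp)
    rw [← ENNReal.toReal_le_toReal (by simp) (measure_ne_top_of_subset inter_subset_left hfin),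
      Real.volume_Ioc, sub_zero, ENNReal.toReal_ofReal ha0]
    exact hfull.ge
  exact e1.symm.trans e2

/-! ### Greedy enumeration and the eigenvalues of diagonal operators -/

/-- `σ` lists the indices of the sequence `μ` greedily: at each step it picks an index where `μ`
is largest among the indices not yet picked. -/
structure IsGreedy (μ : ℕ → ℝ) (σ : ℕ → ℕ) : Prop where
  injective : Function.Injective σ
  le : ∀ k j, (∀ i < k, σ i ≠ j) → μ j ≤ μ (σ k)

theorem isGreedy_id {μ : ℕ → ℝ} (hμ : Antitone μ) : IsGreedy μ id where
  injective := Function.injective_id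
  le k j hj := hμ (by
    by_contra! h
    exact hj j h rfl)

theorem exists_isGreedy {μ : ℕ → ℝ} (hpos : ∀ j, 0 < μ j) (hlim : Tendsto μ atTop (𝓝 0)) :
    ∃ σ, IsGreedy μ σ := by
  have hmax : ∀ A : Finset ℕ, ∃ i ∉ A, ∀ j ∉ A, μ j ≤ μ i := by
    intro A
    obtain ⟨m, hm⟩ := Infinite.exists_notMem_finset A
    obtain ⟨N, hN⟩ := eventually_atTop.1 (hlim.eventually (gt_mem_nhds (hpos m)))
    -- This finite range contains $m$ and every index with value at least $\mu_m$, so a maximum over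
    -- its part outside $A$ is a maximum over the whole complement of $A$.
    have hmem : m ∈ (Finset.range (N + m + 1)) \ A := by simp [hm]
    obtain ⟨i, hi, hmax⟩ := Finset.exists_max_image _ μ ⟨m, hmem⟩
    refine ⟨i, (Finset.mem_sdiff.1 hi).2, fun j hj => ?_⟩
    rcases lt_or_ge j (N + m + 1) with h | h
    · exact hmax j (by simp [hj, h])
    · exact (hN j (by omega)).le.trans (hmax m hmem)
  choose g hgA hg using hmax
  let A : ℕ → Finset ℕ := fun n => (fun B => insert (g B) B)^[n] ∅
  have hA : ∀ n, A (n + 1) = insert (g (A n)) (A n) := fun n =>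
    Function.iterate_succ_apply' (fun B => insert (g B) B) n ∅
  have hmem : ∀ n j, j ∈ A n ↔ ∃ i < n, g (A i) = j := by
    intro n
    induction n with
    | zero => simp [A]
    | succ n ih =>
      intro j
      rw [hA, Finset.mem_insert, ih]
      grind
  refine ⟨fun n => g (A n), ?_, fun k j hj => hg _ _ fun h => ?_⟩
  · have hne : ∀ m n, m < n → g (A m) ≠ g (A n) := fun m n h he =>
      hgA (A n) ((hmem n _).2 ⟨m, h, he⟩)
    intro m n h
    rcases lt_trichotomy m n with h' | h' | h'
    · exact absurd h (hne m n h')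
    · exact h'
    · exact absurd h.symm (hne n m h')
  · obtain ⟨i, hi, he⟩ := (hmem k j).1 h
    exact hj i hi he

section Diagonal

variable {H : Type*} [NormedAddCommGroup H] [InnerProductSpace ℂ H]

/-- The operator `T` is diagonal, with eigenvalues `μ j`, in the total orthogonal system `e j`. -/
structure IsDiagonal (T : H →L[ℂ] H) (e : ℕ → H) (μ : ℕ → ℝ) : Prop where
  ne_zero : ∀ j, e j ≠ 0
  orthogonal : Pairwise fun i j => inner ℂ (e i) (e j) = 0
  total : ∀ x, (∀ j, inner ℂ (e j) x = 0) → x = 0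
  inner_apply : ∀ j x, inner ℂ (e j) (T x) = μ j * inner ℂ (e j) x

variable {T : H →L[ℂ] H} {e : ℕ → H} {μ : ℕ → ℝ}

namespace IsDiagonal

theorem ext (h : IsDiagonal T e μ) {x y : H} (hxy : ∀ j, inner ℂ (e j) x = inner ℂ (e j) y) :
    x = y :=
  sub_eq_zero.1 <| h.total _ fun j => by rw [inner_sub_right, hxy, sub_self]

theorem apply_basis (h : IsDiagonal T e μ) (j : ℕ) : T (e j) = (μ j : ℂ) • e j := by
  refine h.ext fun i => ?_
  rw [h.inner_apply, inner_smul_right]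
  rcases eq_or_ne i j with rfl | hij
  · rfl
  · rw [h.orthogonal hij, mul_zero, mul_zero]

theorem mem_eigenspace (h : IsDiagonal T e μ) (j : ℕ) :
    e j ∈ Module.End.eigenspace (T : Module.End ℂ H) (μ j : ℂ) :=
  Module.End.mem_eigenspace_iff.2 (h.apply_basis j)

theorem inner_eq_zero (h : IsDiagonal T e μ) {ν : ℝ} {x : H}
    (hx : x ∈ Module.End.eigenspace (T : Module.End ℂ H) (ν : ℂ)) {j : ℕ} (hj : μ j ≠ ν) :
    inner ℂ (e j) x = 0 := by
  have h1 : T x = (ν : ℂ) • x := Module.End.mem_eigenspace_iff.1 hx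
  have h2 := h.inner_apply j x
  rw [h1, inner_smul_right] at h2
  have h3 : ((μ j : ℂ) - ν) * inner ℂ (e j) x = 0 := by rw [sub_mul, h2, sub_self]
  refine (mul_eq_zero.1 h3).resolve_left ?_
  exact sub_ne_zero.2 (by exact_mod_cast hj)

theorem hasEigenvalue_iff (h : IsDiagonal T e μ) (ν : ℝ) :
    Module.End.HasEigenvalue (T : Module.End ℂ H) (ν : ℂ) ↔ ∃ j, μ j = ν := by
  constructor
  · intro hν
    obtain ⟨x, hx⟩ := hν.exists_hasEigenvector
    by_contra! hne
    exact hx.2 (h.total x fun j => h.inner_eq_zero hx.1 (hne j))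
  · rintro ⟨j, rfl⟩
    exact Module.End.hasEigenvalue_of_hasEigenvector ⟨h.mem_eigenspace j, h.ne_zero j⟩

theorem card_le_rank (h : IsDiagonal T e μ) {ν : ℝ} (A : Finset ℕ) (hA : ∀ j ∈ A, ν ≤ μ j) :
    (A.card : Cardinal) ≤ Module.rank ℂ
      (⨆ κ : ℝ, ⨆ _ : ν ≤ κ, Module.End.eigenspace (T : Module.End ℂ H) (κ : ℂ) :
        Submodule ℂ H) := by
  set W : Submodule ℂ H :=
    ⨆ κ : ℝ, ⨆ _ : ν ≤ κ, Module.End.eigenspace (T : Module.End ℂ H) (κ : ℂ) with hW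
  have hmem : ∀ j : A, e j ∈ W := fun j =>
    (le_iSup₂_of_le (f := fun (κ : ℝ) (_ : ν ≤ κ) =>
      Module.End.eigenspace (T : Module.End ℂ H) (κ : ℂ)) (μ j) (hA j j.2) le_rfl)
      (h.mem_eigenspace j)
  have hli : LinearIndependent ℂ e := linearIndependent_of_ne_zero_of_inner_eq_zero h.ne_zero
    h.orthogonal
  have hli' : LinearIndependent ℂ fun j : A => (⟨e j, hmem j⟩ : W) := by
    refine LinearIndependent.of_comp W.subtype ?_
    exact hli.comp ((↑) : A → ℕ) Subtype.val_injective
  simpa using hli'.cardinal_lift_le_rank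

/-- An eigenvector for an eigenvalue at least $\nu$ is orthogonal to every $e_j$ with $j\notin A$,
so by totality it equals its finite expansion over $A$. -/
theorem rank_le_card (h : IsDiagonal T e μ) {ν : ℝ} (A : Finset ℕ) (hA : ∀ j, ν ≤ μ j → j ∈ A) :
    Module.rank ℂ
      (⨆ κ : ℝ, ⨆ _ : ν ≤ κ, Module.End.eigenspace (T : Module.End ℂ H) (κ : ℂ) :
        Submodule ℂ H) ≤ A.card := by
  classical
  have hsub : (⨆ κ : ℝ, ⨆ _ : ν ≤ κ, Module.End.eigenspace (T : Module.End ℂ H) (κ : ℂ) :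
      Submodule ℂ H) ≤ Submodule.span ℂ (A.image e : Set H) := by
    refine iSup₂_le fun κ hκ x hx => ?_
    have hx' : x = ∑ j ∈ A, (inner ℂ (e j) x / inner ℂ (e j) (e j)) • e j := by
      refine h.ext fun i => ?_
      rw [inner_sum]
      simp only [inner_smul_right]
      by_cases hi : i ∈ A
      · rw [Finset.sum_eq_single i (fun j _ hj => by rw [h.orthogonal hj.symm, mul_zero])
          (fun h' => absurd hi h'),
          div_mul_cancel₀ _ (inner_self_ne_zero.2 (h.ne_zero i))]
      · rw [h.inner_eq_zero hx (fun he => hi (hA i (hκ.trans_eq he.symm))), Finset.sum_eq_zero]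
        intro j hj
        rw [h.orthogonal (fun he : i = j => hi (he ▸ hj)), mul_zero]
    rw [hx']
    exact Submodule.sum_mem _ fun j hj => Submodule.smul_mem _ _
      (Submodule.subset_span (by simpa using ⟨j, hj, rfl⟩))
  refine (Submodule.rank_mono hsub).trans ((rank_span_finset_le _).trans ?_)
  exact_mod_cast Finset.card_image_le

/-- The first $k+1$ picks have values at least $\mu_{\sigma(k)}$, whereas any larger threshold is
reached only among the first $k$ picks. The shift is due to eigenvalues being numbered from $1$. -/
theorem nthEigenvalue_eq (h : IsDiagonal T e μ) {σ : ℕ → ℕ} (hσ : IsGreedy μ σ) (k : ℕ) :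
    nthEigenvalue T (k + 1) = μ (σ k) := by
  refine IsGreatest.csSup_eq ⟨⟨(h.hasEigenvalue_iff _).2 ⟨_, rfl⟩, ?_⟩, ?_⟩
  · have := h.card_le_rank (ν := μ (σ k)) ((Finset.range (k + 1)).image σ) fun j hj => by
      obtain ⟨i, hi, rfl⟩ := Finset.mem_image.1 hj
      refine hσ.le i _ fun l hl he => ?_
      have := hσ.injective he
      have := Finset.mem_range.1 hi
      omega
    rwa [Finset.card_image_of_injective _ hσ.injective, Finset.card_range] at this
  · rintro ν ⟨-, hν⟩
    by_contra! hlt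
    have := h.rank_le_card (ν := ν) ((Finset.range k).image σ) fun j hj => by
      by_contra hne
      have := hσ.le k j fun i hi he => hne (Finset.mem_image.2 ⟨i, Finset.mem_range.2 hi, he⟩)
      linarith
    rw [Finset.card_image_of_injective _ hσ.injective, Finset.card_range] at this
    have := Nat.cast_le.1 (hν.trans this)
    omega

end IsDiagonal

end Diagonal

/-! ### Integration over radial sets -/

/-- The map `z ↦ π |z|²` pushes the area measure of the plane forward to the length measure of the
half-line. -/
theorem measurePreserving_pi_mul_norm_sq :
    MeasurePreserving (fun z : ℂ => Real.pi * ‖z‖ ^ 2) volume (volume.restrict (Ioi 0)) := by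
  have hm : Measurable fun z : ℂ => Real.pi * ‖z‖ ^ 2 := by fun_prop
  refine ⟨hm, (Measure.ext_of_Ioc _ _ fun a b hab => ?_).symm⟩
  have hball : ∀ c : ℝ, volume {z : ℂ | Real.pi * ‖z‖ ^ 2 ≤ c} = ENNReal.ofReal c := by
    intro c
    rcases lt_or_ge c 0 with hc | hc
    · rw [ENNReal.ofReal_of_nonpos hc.le]
      convert measure_empty (μ := (volume : Measure ℂ))
      refine eq_empty_of_forall_notMem fun z hz => ?_
      have h1 : 0 ≤ Real.pi * ‖z‖ ^ 2 := by positivity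
      exact absurd (h1.trans hz) (not_le.2 hc)
    · have e : {z : ℂ | Real.pi * ‖z‖ ^ 2 ≤ c} = Metric.closedBall 0 (√(c / Real.pi)) := by
        ext z
        simp only [mem_ofPred_eq, mem_closedBall_zero_iff]
        rw [Real.le_sqrt (norm_nonneg z) (by positivity), le_div_iff₀ Real.pi_pos, mul_comm]
      rw [e, Complex.volume_closedBall, ← ENNReal.ofReal_pow (Real.sqrt_nonneg _),
        Real.sq_sqrt (by positivity), ← ENNReal.ofReal_coe_nnreal, NNReal.coe_real_pi,
        ← ENNReal.ofReal_mul (by positivity), div_mul_cancel₀ _ Real.pi_ne_zero]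
  rw [Measure.map_apply hm measurableSet_Ioc, Measure.restrict_apply measurableSet_Ioc,
    Ioc_inter_Ioi, Real.volume_Ioc]
  have e : (fun z : ℂ => Real.pi * ‖z‖ ^ 2) ⁻¹' Ioc a b =
      {z : ℂ | Real.pi * ‖z‖ ^ 2 ≤ b} \ {z : ℂ | Real.pi * ‖z‖ ^ 2 ≤ a} := by
    ext z
    simp [and_comm]
  have hsub : {z : ℂ | Real.pi * ‖z‖ ^ 2 ≤ a} ⊆ {z : ℂ | Real.pi * ‖z‖ ^ 2 ≤ b} :=
    fun z (hz : Real.pi * ‖z‖ ^ 2 ≤ a) => hz.trans hab.le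
  rw [e, measure_sdiff hsub (measurableSet_le hm measurable_const).nullMeasurableSet
    (by rw [hball]; simp), hball, hball]
  rcases le_total a 0 with ha | ha
  · rw [ENNReal.ofReal_of_nonpos ha, max_eq_right ha, sub_zero, tsub_zero]
  · rw [max_eq_left ha, ENNReal.ofReal_sub _ ha]

/-- An integral over the plane may be computed by first averaging over rotations. -/
theorem integral_eq_of_rotation_average {f m : ℂ → ℂ} (hf : Integrable f)
    (hm : ∀ z, ∫ θ in (0 : ℝ)..2 * Real.pi, f (Complex.exp (θ * Complex.I) * z) =
      2 * Real.pi * m z) : ∫ z, f z = ∫ z, m z := by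
  set ν : Measure ℝ := volume.restrict (uIoc 0 (2 * Real.pi)) with hν
  have : IsFiniteMeasure ν := ⟨by rw [hν, Measure.restrict_apply_univ, uIoc]; simp⟩
  have hg : Measurable (Function.uncurry fun (θ : ℝ) (z : ℂ) =>
      Complex.exp (θ * Complex.I) * z) := by
    unfold Function.uncurry
    fun_prop
  have hrot : ∀ θ : ℝ, MeasurePreserving (fun z : ℂ => Complex.exp (θ * Complex.I) * z)
      volume volume := by
    intro θ
    have := (rotation (Circle.exp θ)).measurePreserving
    simpa [rotation_apply, Circle.coe_exp] using! this
  -- The skew product of rotations preserves the product measure, which supplies the joint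
  -- integrability needed for Fubini.
  have hsk : MeasurePreserving
      (fun p : ℝ × ℂ => (p.1, Complex.exp (p.1 * Complex.I) * p.2))
      (ν.prod (volume : Measure ℂ)) (ν.prod (volume : Measure ℂ)) :=
    (MeasurePreserving.id ν).skew_product hg (Eventually.of_forall fun θ => (hrot θ).map_eq)
  have hint : Integrable (Function.uncurry fun (θ : ℝ) (z : ℂ) =>
      f (Complex.exp (θ * Complex.I) * z)) (ν.prod (volume : Measure ℂ)) :=
    hsk.integrable_comp_of_integrable (hf.comp_snd ν)
  have hsw := intervalIntegral_integral_swap hint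
  simp_rw [hm] at hsw
  have hrot' : ∀ θ : ℝ, ∫ z, f (Complex.exp (θ * Complex.I) * z) = ∫ z, f z := by
    intro θ
    have := (rotation (Circle.exp θ)).measurePreserving.integral_comp
      (rotation (Circle.exp θ)).toHomeomorph.measurableEmbedding f
    simpa [rotation_apply, Circle.coe_exp] using this
  simp_rw [hrot'] at hsw
  rw [intervalIntegral.integral_const, integral_const_mul, sub_zero, Complex.real_smul] at hsw
  push_cast at hsw
  exact mul_left_cancel₀ (by simp [Real.pi_ne_zero]) hsw

/-- The `j`-th Taylor coefficient at the origin. -/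
def taylorCoeff (G : ℂ → ℂ) (j : ℕ) : ℂ := iteratedDeriv j G 0 / j.factorial

theorem taylorCoeff_pow (i j : ℕ) :
    taylorCoeff (fun z => z ^ i) j = if i = j then 1 else 0 := by
  rw [taylorCoeff, iteratedDeriv_fun_pow_zero]
  rcases eq_or_ne i j with rfl | h
  · rw [if_pos rfl, if_pos rfl]
    exact div_self (by exact_mod_cast i.factorial_ne_zero)
  · rw [if_neg h.symm, if_neg h, Nat.cast_zero, zero_div]

theorem eq_zero_of_taylorCoeff {G : ℂ → ℂ} (hG : Differentiable ℂ G)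
    (h : ∀ j, taylorCoeff G j = 0) : G = 0 := by
  funext z
  rw [← Complex.taylorSeries_eq_of_entire' 0 z hG]
  refine (tsum_congr fun j => ?_).trans tsum_zero
  have := h j
  rw [taylorCoeff, div_eq_inv_mul] at this
  rw [this, zero_mul]

/-- The average over a circle of an entire function against a conjugate monomial. -/
theorem integral_conj_pow_mul {G : ℂ → ℂ} (hG : Differentiable ℂ G) (j : ℕ) (z : ℂ) :
    ∫ θ in (0 : ℝ)..2 * Real.pi, (starRingEnd ℂ) (Complex.exp (θ * Complex.I) * z) ^ j *
      G (Complex.exp (θ * Complex.I) * z) =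
      2 * Real.pi * (taylorCoeff G j * (‖z‖ : ℂ) ^ (2 * j)) := by
  -- Cauchy's formula is applied to $\zeta\mapsto G(z\zeta)$ on the unit circle, not to $G$ on the
  -- circle of radius $|z|$: this includes $z=0$ and produces the factor $z^j$.
  have hd : Differentiable ℂ fun ζ => G (z * ζ) := hG.comp (differentiable_id.const_mul z)
  have h := DiffContOnCl.circleIntegral_one_div_sub_center_pow_smul (c := 0) one_pos j
    hd.diffContOnCl
  rw [iteratedDeriv_comp_const_mul hG.contDiff] at h
  rw [circleIntegral] at h
  have e : ∀ θ : ℝ, deriv (circleMap 0 1) θ •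
      (1 / (circleMap 0 1 θ - 0) ^ (j + 1)) • G (z * circleMap 0 1 θ) =
      Complex.I * ((starRingEnd ℂ) (Complex.exp (θ * Complex.I)) ^ j *
        G (Complex.exp (θ * Complex.I) * z)) := by
    intro θ
    have h0 := Complex.exp_ne_zero (θ * Complex.I)
    have h1 : (starRingEnd ℂ) (Complex.exp (θ * Complex.I)) =
        (Complex.exp (θ * Complex.I))⁻¹ := by
      rw [← Complex.exp_conj, ← Complex.exp_neg]
      simp
    rw [deriv_circleMap, h1]
    simp only [circleMap, Complex.ofReal_one, one_mul, zero_add, sub_zero, smul_eq_mul]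
    rw [mul_comm z, pow_succ, inv_pow]
    field_simp
  simp_rw [e] at h
  rw [intervalIntegral.integral_const_mul] at h
  have e2 : ∀ θ : ℝ, (starRingEnd ℂ) (Complex.exp (θ * Complex.I) * z) ^ j *
      G (Complex.exp (θ * Complex.I) * z) = (starRingEnd ℂ) z ^ j *
      ((starRingEnd ℂ) (Complex.exp (θ * Complex.I)) ^ j *
        G (Complex.exp (θ * Complex.I) * z)) := by
    intro θ
    rw [map_mul, mul_pow]
    ring
  simp_rw [e2]
  rw [intervalIntegral.integral_const_mul]
  have h3 : ∫ θ in (0 : ℝ)..2 * Real.pi, (starRingEnd ℂ) (Complex.exp (θ * Complex.I)) ^ j *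
        G (Complex.exp (θ * Complex.I) * z) = 2 * Real.pi * (taylorCoeff G j * z ^ j) := by
    refine mul_left_cancel₀ Complex.I_ne_zero ?_
    rw [h, mul_zero, taylorCoeff, smul_eq_mul]
    ring
  have h4 : (‖z‖ : ℂ) ^ (2 * j) = (starRingEnd ℂ) z ^ j * z ^ j := by
    rw [pow_mul, ← Complex.conj_mul', mul_pow]
  rw [h3, h4]
  ring

/-- The constant $j!/\pi^j$ is the squared norm of $z^j$ in the Fock space, as $p_j$ has total mass
$1$. -/
theorem norm_pow_mul_exp_eq (j : ℕ) (z : ℂ) :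
    ‖z‖ ^ (2 * j) * Real.exp (-Real.pi * ‖z‖ ^ 2) =
      j.factorial / Real.pi ^ j * poissonWeight j (Real.pi * ‖z‖ ^ 2) := by
  have : (j.factorial : ℝ) ≠ 0 := by positivity
  have := Real.pi_ne_zero
  rw [poissonWeight, mul_pow, ← pow_mul, neg_mul]
  field_simp

/-- The integral over a radial set of an entire function against a conjugate monomial. -/
theorem integral_radial {G : ℂ → ℂ} (hG : Differentiable ℂ G) (j : ℕ)
    (hint : Integrable fun z : ℂ =>
      (starRingEnd ℂ) z ^ j * G z * Real.exp (-Real.pi * ‖z‖ ^ 2))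
    {S : Set ℝ} (hS : MeasurableSet S) (hpos : S ⊆ Ioi 0) :
    ∫ z in {z : ℂ | Real.pi * ‖z‖ ^ 2 ∈ S},
      (starRingEnd ℂ) z ^ j * G z * Real.exp (-Real.pi * ‖z‖ ^ 2) =
      taylorCoeff G j * (j.factorial / Real.pi ^ j * ∫ s in S, poissonWeight j s : ℝ) := by
  have hρ := measurePreserving_pi_mul_norm_sq
  have hm : MeasurableSet {z : ℂ | Real.pi * ‖z‖ ^ 2 ∈ S} := hρ.measurable hS
  rw [← integral_indicator hm]
  set κ : ℂ → ℝ := fun z => S.indicator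
    (fun s => j.factorial / Real.pi ^ j * poissonWeight j s) (Real.pi * ‖z‖ ^ 2) with hκ
  rw [integral_eq_of_rotation_average (m := fun z => taylorCoeff G j * (κ z : ℂ))
    (hint.indicator hm)]
  · have hmap := integral_map (μ := volume) hρ.measurable.aemeasurable
      (f := S.indicator fun s => j.factorial / Real.pi ^ j * poissonWeight j s)
      (((continuous_poissonWeight j).measurable.const_mul _).indicator hS).aestronglyMeasurable
    rw [hρ.map_eq, integral_indicator hS, Measure.restrict_restrict hS,
      inter_eq_left.2 hpos, integral_const_mul] at hmap
    rw [integral_const_mul, integral_complex_ofReal, hmap]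
  · intro z
    by_cases hz : Real.pi * ‖z‖ ^ 2 ∈ S
    · have e : ∀ θ : ℝ, {z : ℂ | Real.pi * ‖z‖ ^ 2 ∈ S}.indicator
          (fun z => (starRingEnd ℂ) z ^ j * G z * Real.exp (-Real.pi * ‖z‖ ^ 2))
          (Complex.exp (θ * Complex.I) * z) =
          (starRingEnd ℂ) (Complex.exp (θ * Complex.I) * z) ^ j *
            G (Complex.exp (θ * Complex.I) * z) * (Real.exp (-Real.pi * ‖z‖ ^ 2) : ℝ) := by
        intro θ
        have hn : ‖Complex.exp (θ * Complex.I) * z‖ = ‖z‖ := by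
          rw [norm_mul, Complex.norm_exp_ofReal_mul_I, one_mul]
        rw [indicator_of_mem (by simpa only [mem_ofPred_eq, hn] using hz), hn]
      simp_rw [e]
      rw [intervalIntegral.integral_mul_const, integral_conj_pow_mul hG, hκ]
      simp only
      rw [indicator_of_mem hz, ← norm_pow_mul_exp_eq]
      push_cast
      ring
    · have e : ∀ θ : ℝ, {z : ℂ | Real.pi * ‖z‖ ^ 2 ∈ S}.indicator
          (fun z => (starRingEnd ℂ) z ^ j * G z * Real.exp (-Real.pi * ‖z‖ ^ 2))
          (Complex.exp (θ * Complex.I) * z) = 0 := by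
        intro θ
        have hn : ‖Complex.exp (θ * Complex.I) * z‖ = ‖z‖ := by
          rw [norm_mul, Complex.norm_exp_ofReal_mul_I, one_mul]
        rw [indicator_of_notMem (by simpa only [mem_ofPred_eq, hn] using hz)]
      simp_rw [e]
      simp [hκ, hz]

/-! ### Diagonalisation in the centred monomials -/

theorem tendsto_poissonTail_atTop (k : ℕ) : Tendsto (poissonTail k) atTop (𝓝 1) := by
  have h := tendsto_finsetSum (Finset.range (k + 1)) fun l _ => tendsto_poissonWeight_atTop l
  simpa [poissonTail] using! h.const_sub 1

theorem integrableOn_Ioi_poissonWeight (k : ℕ) : IntegrableOn (poissonWeight k) (Ioi 0) :=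
  integrableOn_Ioi_deriv_of_nonneg' (fun s _ => hasDerivAt_poissonTail k s)
    (fun _ hs => poissonWeight_nonneg k (le_of_lt hs)) (tendsto_poissonTail_atTop k)

theorem integral_Ioi_poissonWeight (k : ℕ) : ∫ s in Ioi 0, poissonWeight k s = 1 := by
  rw [integral_Ioi_of_hasDerivAt_of_nonneg' (fun s _ => hasDerivAt_poissonTail k s)
    (fun _ hs => poissonWeight_nonneg k (le_of_lt hs)) (tendsto_poissonTail_atTop k),
    poissonTail_zero, sub_zero]

theorem measurable_gaussianDensity :
    Measurable fun z : ℂ => ENNReal.ofReal (Real.exp (-Real.pi * ‖z‖ ^ 2)) := by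
  fun_prop

theorem integrable_gaussianMeasure_iff {f : ℂ → ℂ} :
    Integrable f gaussianMeasure ↔
      Integrable fun z => (Real.exp (-Real.pi * ‖z‖ ^ 2) : ℂ) * f z := by
  rw [gaussianMeasure, integrable_withDensity_iff_integrable_smul' measurable_gaussianDensity
    (Eventually.of_forall fun _ => ENNReal.ofReal_lt_top)]
  refine integrable_congr (Eventually.of_forall fun z => ?_)
  simp only [ENNReal.toReal_ofReal (Real.exp_pos _).le, Complex.real_smul]

theorem setIntegral_gaussianMeasure (f : ℂ → ℂ) {Ω : Set ℂ} (hΩ : MeasurableSet Ω) :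
    ∫ z in Ω, f z ∂gaussianMeasure =
      ∫ z in Ω, (Real.exp (-Real.pi * ‖z‖ ^ 2) : ℂ) * f z := by
  rw [gaussianMeasure, setIntegral_withDensity_eq_setIntegral_toReal_smul
    measurable_gaussianDensity (Eventually.of_forall fun _ => ENNReal.ofReal_lt_top) _ hΩ]
  refine integral_congr_ae (Eventually.of_forall fun z => ?_)
  simp only [ENNReal.toReal_ofReal (Real.exp_pos _).le, Complex.real_smul]

/-- The monomials centred at `w`, in the Fock space. -/
def centredMonomial (w : ℂ) (j : ℕ) (z : ℂ) : ℂ :=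
  (z - w) ^ j * Complex.exp (Real.pi * (starRingEnd ℂ) w * (z - w))

/-- The entire function whose Taylor coefficients at the origin are the coordinates of `F` with
respect to the monomials centred at `w`. -/
def recentre (w : ℂ) (F : ℂ → ℂ) (ζ : ℂ) : ℂ :=
  F (ζ + w) * Complex.exp (-(Real.pi * (starRingEnd ℂ) w * ζ))

theorem differentiable_centredMonomial (w : ℂ) (j : ℕ) :
    Differentiable ℂ (centredMonomial w j) := by
  unfold centredMonomial
  fun_prop

theorem differentiable_recentre (w : ℂ) {F : ℂ → ℂ} (hF : Differentiable ℂ F) :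
    Differentiable ℂ (recentre w F) := by
  unfold recentre
  fun_prop

theorem recentre_centredMonomial (w : ℂ) (j : ℕ) :
    recentre w (centredMonomial w j) = fun ζ => ζ ^ j := by
  funext ζ
  simp only [recentre, centredMonomial, add_sub_cancel_right]
  rw [mul_assoc, ← Complex.exp_add, add_neg_cancel, Complex.exp_zero, mul_one]

theorem eq_zero_of_recentre {w : ℂ} {F : ℂ → ℂ} (h : recentre w F = 0) : F = 0 := by
  funext z
  have := congrFun h (z - w)
  simpa [recentre, Complex.exp_ne_zero] using this

/-- In the expansion of $|\zeta+w|^2$, one cross term cancels against the conjugated exponential of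
the centred monomial and the other is the exponential in `recentre`. A problem centred at $w$ is
thus moved to the origin, up to a constant. -/
theorem weight_mul_conj_centredMonomial_mul (w : ℂ) (j : ℕ) (F : ℂ → ℂ) (ζ : ℂ) :
    (Real.exp (-Real.pi * ‖ζ + w‖ ^ 2) : ℂ) *
      ((starRingEnd ℂ) (centredMonomial w j (ζ + w)) * F (ζ + w)) =
    Real.exp (-Real.pi * ‖w‖ ^ 2) * ((starRingEnd ℂ) ζ ^ j * recentre w F ζ *
      Real.exp (-Real.pi * ‖ζ‖ ^ 2)) := by
  have h : Complex.exp (-Real.pi * ‖ζ + w‖ ^ 2) *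
      Complex.exp (Real.pi * w * (starRingEnd ℂ) ζ) =
      Complex.exp (-Real.pi * ‖w‖ ^ 2) *
      (Complex.exp (-(Real.pi * (starRingEnd ℂ) w * ζ)) * Complex.exp (-Real.pi * ‖ζ‖ ^ 2)) := by
    rw [← Complex.exp_add, ← Complex.exp_add, ← Complex.exp_add, ← Complex.conj_mul',
      ← Complex.conj_mul', ← Complex.conj_mul', map_add]
    congr 1
    ring
  simp only [centredMonomial, recentre, add_sub_cancel_right, map_mul, map_pow,
    ← Complex.exp_conj, Complex.conj_ofReal, Complex.conj_conj]
  push_cast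
  linear_combination (starRingEnd ℂ) ζ ^ j * F (ζ + w) * h

theorem memLp_centredMonomial (w : ℂ) (j : ℕ) : MemLp (centredMonomial w j) 2 gaussianMeasure := by
  have hρ := measurePreserving_pi_mul_norm_sq
  have h1 : Integrable fun ζ : ℂ =>
      (j.factorial / Real.pi ^ j * poissonWeight j (Real.pi * ‖ζ‖ ^ 2) : ℝ) :=
    (hρ.integrable_comp_of_integrable (integrableOn_Ioi_poissonWeight j)).const_mul _
  have h2 : Integrable fun ζ : ℂ => (Real.exp (-Real.pi * ‖w‖ ^ 2) : ℂ) *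
      ((starRingEnd ℂ) ζ ^ j * recentre w (centredMonomial w j) ζ *
        Real.exp (-Real.pi * ‖ζ‖ ^ 2)) := by
    refine Integrable.const_mul ?_ _
    refine (h1.ofReal (𝕜 := ℂ)).congr (Eventually.of_forall fun ζ => ?_)
    simp only [recentre_centredMonomial]
    rw [← norm_pow_mul_exp_eq, ← mul_pow, Complex.conj_mul', ← pow_mul]
    simp
  have h3 : Integrable (fun z => (starRingEnd ℂ) (centredMonomial w j z) * centredMonomial w j z)
      gaussianMeasure := by
    rw [integrable_gaussianMeasure_iff]
    refine (h2.comp_sub_right w).congr (Eventually.of_forall fun z => ?_)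
    simp only [← weight_mul_conj_centredMonomial_mul, sub_add_cancel]
  rw [memLp_two_iff_integrable_sq_norm
    (differentiable_centredMonomial w j).continuous.aestronglyMeasurable]
  refine h3.norm.congr (Eventually.of_forall fun z => ?_)
  simp only [norm_mul, RCLike.norm_conj, sq]

/-- The monomials centred at `w`, as elements of the Fock space. -/
def basisVector (w : ℂ) (j : ℕ) : fock :=
  ⟨(memLp_centredMonomial w j).toLp _, centredMonomial w j, differentiable_centredMonomial w j,
    MemLp.coeFn_toLp _⟩

/-- The set of the points `z` with `π |z - w|² ∈ S`. -/
def radialSet (w : ℂ) (S : Set ℝ) : Set ℂ := {z | Real.pi * ‖z - w‖ ^ 2 ∈ S}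

theorem measurePreserving_centred (w : ℂ) :
    MeasurePreserving (fun z : ℂ => Real.pi * ‖z - w‖ ^ 2) volume (volume.restrict (Ioi 0)) :=
  measurePreserving_pi_mul_norm_sq.comp (measurePreserving_sub_right volume w)

theorem measurableSet_radialSet (w : ℂ) {S : Set ℝ} (hS : MeasurableSet S) :
    MeasurableSet (radialSet w S) :=
  (measurePreserving_centred w).measurable hS

theorem setIntegral_conj_centredMonomial_mul {F : ℂ → ℂ} (hF : Differentiable ℂ F)
    (hL : MemLp F 2 gaussianMeasure) (w : ℂ) (j : ℕ) {S : Set ℝ} (hS : MeasurableSet S)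
    (hpos : S ⊆ Ioi 0) :
    ∫ z in radialSet w S, (starRingEnd ℂ) (centredMonomial w j z) * F z ∂gaussianMeasure =
      (∫ s in S, poissonWeight j s : ℝ) * (Real.exp (-Real.pi * ‖w‖ ^ 2) *
        (j.factorial / Real.pi ^ j) * taylorCoeff (recentre w F) j) := by
  have hint : Integrable (fun z => (starRingEnd ℂ) (centredMonomial w j z) * F z)
      gaussianMeasure := (memLp_centredMonomial w j).star.integrable_mul hL
  rw [integrable_gaussianMeasure_iff] at hint
  have hint2 := hint.comp_add_right w
  simp_rw [weight_mul_conj_centredMonomial_mul] at hint2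
  rw [integrable_const_mul_iff (by simp)] at hint2
  rw [setIntegral_gaussianMeasure _ (measurableSet_radialSet w hS),
    ← integral_indicator (measurableSet_radialSet w hS),
    ← integral_add_right_eq_self _ w]
  have e : ∀ ζ, (radialSet w S).indicator (fun z => (Real.exp (-Real.pi * ‖z‖ ^ 2) : ℂ) *
      ((starRingEnd ℂ) (centredMonomial w j z) * F z)) (ζ + w) =
      {z : ℂ | Real.pi * ‖z‖ ^ 2 ∈ S}.indicator (fun ζ => Real.exp (-Real.pi * ‖w‖ ^ 2) *
        ((starRingEnd ℂ) ζ ^ j * recentre w F ζ * Real.exp (-Real.pi * ‖ζ‖ ^ 2))) ζ := by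
    intro ζ
    classical
    rw [indicator_apply, indicator_apply, weight_mul_conj_centredMonomial_mul]
    simp only [radialSet, mem_ofPred_eq, add_sub_cancel_right]
  simp_rw [e]
  have hm : MeasurableSet {z : ℂ | Real.pi * ‖z‖ ^ 2 ∈ S} :=
    measurePreserving_pi_mul_norm_sq.measurable hS
  rw [integral_indicator hm, integral_const_mul,
    integral_radial (differentiable_recentre w hF) j hint2 hS hpos]
  push_cast
  ring

/-- The Toeplitz operator of a radial set is diagonal in the centred monomials. -/
theorem isDiagonal_toeplitz {Ω : Set ℂ} (hΩ : NullMeasurableSet Ω volume) {w : ℂ} {S : Set ℝ}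
    (hS : MeasurableSet S) (hpos : S ⊆ Ioi 0) (hΩS : Ω =ᵐ[volume] radialSet w S) :
    IsDiagonal (toeplitz Ω hΩ) (basisVector w) fun j => ∫ s in S, poissonWeight j s := by
  have hac : gaussianMeasure ≪ volume := withDensity_absolutelyContinuous _ _
  -- The set is left arbitrary because the formula is used twice: for $\Omega$, and for the whole
  -- plane with $S'=(0,\infty)$, where it gives the plain inner product.
  have hrep : ∀ (x : fock) {F : ℂ → ℂ}, (x : Lp ℂ 2 gaussianMeasure) =ᵐ[gaussianMeasure] F →
      Differentiable ℂ F → ∀ j {Ω' : Set ℂ} {S' : Set ℝ} (hΩ' : NullMeasurableSet Ω' volume),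
      MeasurableSet S' → S' ⊆ Ioi 0 →
      Ω' =ᵐ[volume] radialSet w S' →
      inner ℂ ((basisVector w j : fock) : Lp ℂ 2 gaussianMeasure)
        (mulIndicator Ω' hΩ' (x : Lp ℂ 2 gaussianMeasure)) =
      (∫ s in S', poissonWeight j s : ℝ) * (Real.exp (-Real.pi * ‖w‖ ^ 2) *
        (j.factorial / Real.pi ^ j) * taylorCoeff (recentre w F) j) := by
    intro x F hxF hF j Ω' S' hΩ' hS' hpos' hΩS'
    rw [← setIntegral_conj_centredMonomial_mul hF
      ((memLp_congr_ae hxF).1 (Lp.memLp _)) w j hS' hpos',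
      ← integral_indicator (measurableSet_radialSet w hS'), L2.inner_def]
    refine integral_congr_ae ?_
    filter_upwards [hxF, MemLp.coeFn_toLp (memLp_centredMonomial w j),
      MemLp.coeFn_toLp (memLp_indicator_aux hΩ' (x : Lp ℂ 2 gaussianMeasure)),
      hac.ae_eq hΩS'] with z h1 h2 h3 h4
    have h5 : (mulIndicator Ω' hΩ' (x : Lp ℂ 2 gaussianMeasure)) z =
        Ω'.indicator (x : Lp ℂ 2 gaussianMeasure) z := h3
    have h6 : ((basisVector w j : fock) : Lp ℂ 2 gaussianMeasure) z = centredMonomial w j z := h2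
    have h7 : z ∈ Ω' ↔ z ∈ radialSet w S' := iff_of_eq h4
    rw [h5, h6]
    by_cases hz : z ∈ Ω'
    · rw [indicator_of_mem hz, indicator_of_mem (h7.1 hz), h1, RCLike.inner_apply, mul_comm]
    · rw [indicator_of_notMem hz, indicator_of_notMem (fun h => hz (h7.2 h)), inner_zero_right]
  have huniv : (univ : Set ℂ) =ᵐ[volume] radialSet w (Ioi 0) := by
    have : ∀ᵐ z : ℂ, z ≠ w := by simp [ae_iff]
    filter_upwards [this] with z hz
    have : z ∈ radialSet w (Ioi 0) := by
      have := norm_pos_iff.2 (sub_ne_zero.2 hz)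
      simp only [radialSet, mem_ofPred_eq, mem_Ioi]
      have := Real.pi_pos
      positivity
    exact propext ⟨fun _ => this, fun _ => mem_univ z⟩
  have hid : ∀ x : Lp ℂ 2 gaussianMeasure, mulIndicator univ nullMeasurableSet_univ x = x := by
    intro x
    refine Lp.ext ?_
    refine (MemLp.coeFn_toLp (memLp_indicator_aux nullMeasurableSet_univ x)).trans ?_
    rw [indicator_univ]
  have hinner : ∀ (x : fock) {F : ℂ → ℂ}, (x : Lp ℂ 2 gaussianMeasure) =ᵐ[gaussianMeasure] F →
      Differentiable ℂ F → ∀ j, inner ℂ (basisVector w j) x = Real.exp (-Real.pi * ‖w‖ ^ 2) *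
        (j.factorial / Real.pi ^ j) * taylorCoeff (recentre w F) j := by
    intro x F hxF hF j
    have := hrep x hxF hF j nullMeasurableSet_univ measurableSet_Ioi Subset.rfl huniv
    rw [hid, integral_Ioi_poissonWeight, Complex.ofReal_one, one_mul] at this
    rw [← this, Submodule.coe_inner]
  have hbasis : ∀ i j, inner ℂ (basisVector w i) (basisVector w j) =
      Real.exp (-Real.pi * ‖w‖ ^ 2) * (i.factorial / Real.pi ^ i) * if j = i then 1 else 0 := by
    intro i j
    rw [hinner (basisVector w j) (MemLp.coeFn_toLp (memLp_centredMonomial w j))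
      (differentiable_centredMonomial w j), recentre_centredMonomial, taylorCoeff_pow]
  have hconst : ∀ i : ℕ, (Real.exp (-Real.pi * ‖w‖ ^ 2) * (i.factorial / Real.pi ^ i) : ℂ) ≠ 0 := by
    intro i
    have : (i.factorial : ℂ) ≠ 0 := by exact_mod_cast i.factorial_ne_zero
    have : (Real.pi : ℂ) ≠ 0 := by exact_mod_cast Real.pi_ne_zero
    have : (Real.exp (-Real.pi * ‖w‖ ^ 2) : ℂ) ≠ 0 := by exact_mod_cast (Real.exp_pos _).ne'
    positivity
  refine ⟨fun j h => ?_, fun i j hij => ?_, fun x hx => ?_, fun j x => ?_⟩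
  · have := hbasis j j
    rw [h, inner_zero_right, if_pos rfl, mul_one] at this
    exact hconst j this.symm
  · exact (hbasis i j).trans (by rw [if_neg hij.symm, mul_zero])
  · obtain ⟨F, hF, hxF⟩ := x.2
    have h1 : recentre w F = 0 := by
      refine eq_zero_of_taylorCoeff (differentiable_recentre w hF) fun j => ?_
      have := hx j
      rw [hinner x hxF hF] at this
      exact (mul_eq_zero.1 this).resolve_left (hconst j)
    rw [eq_zero_of_recentre h1] at hxF
    refine Subtype.ext (Lp.ext ?_)
    exact hxF.trans (Lp.coeFn_zero ℂ 2 gaussianMeasure).symm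
  · obtain ⟨F, hF, hxF⟩ := x.2
    rw [hinner x hxF hF, ← hrep x hxF hF j hΩ hS hpos hΩS]
    -- The projection drops out of an inner product with a vector of the Fock space.
    exact Submodule.inner_orthogonalProjectionOnto_eq_of_mem_left _ _

/-! ### Circularly symmetric sets and discs as radial sets -/

/-- A circularly symmetric set is, up to a null set, given by a measurable set of values of
`π |z - w|²`. -/
theorem IsCircularlySymmetric.exists_radialSet {Ω : Set ℂ} (h : IsCircularlySymmetric Ω) :
    ∃ (w : ℂ) (S : Set ℝ), MeasurableSet S ∧ S ⊆ Ioi 0 ∧ Ω =ᵐ[volume] radialSet w S := by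
  obtain ⟨w, E, hE, -, rfl⟩ := h
  obtain ⟨t, hEt, ht, hte⟩ := hE.exists_measurable_superset_ae_eq
  refine ⟨w, Ioi 0 ∩ (fun s => √(s / Real.pi)) ⁻¹' t,
    measurableSet_Ioi.inter ((by fun_prop : Measurable fun s : ℝ => √(s / Real.pi)) ht),
    inter_subset_left, ?_⟩
  -- Since $E$ is only null measurable, it is replaced by a measurable superset $t$. The map
  -- $r\mapsto\pi r^2$ is differentiable, so it sends the null set $t\setminus E$ to a null set,
  -- whose preimage in the plane is null.
  have hnull : volume ((fun r : ℝ => Real.pi * r ^ 2) '' (t \ E)) = 0 :=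
    addHaar_image_eq_zero_of_differentiableOn_of_addHaar_eq_zero _ (by fun_prop)
      (ae_le_set.1 hte.le)
  have hnull' := (measurePreserving_centred w).quasiMeasurePreserving.preimage_null
    (le_antisymm ((Measure.restrict_apply_le _ _).trans hnull.le) zero_le)
  have hne : ∀ᵐ z : ℂ, z ≠ w := by simp [ae_iff]
  filter_upwards [hne, measure_eq_zero_iff_ae_notMem.1 hnull'] with z hz hzN
  have hpos : 0 < ‖z - w‖ := norm_pos_iff.2 (sub_ne_zero.2 hz)
  have hsqrt : √(Real.pi * ‖z - w‖ ^ 2 / Real.pi) = ‖z - w‖ := by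
    rw [mul_div_cancel_left₀ _ Real.pi_ne_zero, Real.sqrt_sq hpos.le]
  refine propext ⟨fun (h1 : ‖z - w‖ ∈ E) => ?_, fun h1 => ?_⟩
  · refine ⟨by have := Real.pi_pos; simp only [mem_Ioi]; positivity, ?_⟩
    simp only [mem_preimage, hsqrt]
    exact hEt h1
  · have h2 : √(Real.pi * ‖z - w‖ ^ 2 / Real.pi) ∈ t := h1.2
    rw [hsqrt] at h2
    show ‖z - w‖ ∈ E
    by_contra h3
    exact hzN ⟨‖z - w‖, ⟨h2, h3⟩, rfl⟩

theorem ball_ae_eq_radialSet (c : ℂ) {r : ℝ} (hr : 0 < r) :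
    Metric.ball c r =ᵐ[volume] radialSet c (Ioo 0 (Real.pi * r ^ 2)) := by
  have hne : ∀ᵐ z : ℂ, z ≠ c := by simp [ae_iff]
  filter_upwards [hne] with z hz
  have hpos : 0 < ‖z - c‖ := norm_pos_iff.2 (sub_ne_zero.2 hz)
  refine propext (mem_ball_iff_norm.trans ?_)
  show _ ↔ Real.pi * ‖z - c‖ ^ 2 ∈ Ioo 0 (Real.pi * r ^ 2)
  have h1 : 0 < Real.pi * ‖z - c‖ ^ 2 := by have := Real.pi_pos; positivity
  simp only [mem_Ioo, h1, true_and, mul_lt_mul_iff_right₀ Real.pi_pos]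
  exact (pow_lt_pow_iff_left₀ hpos.le hr.le two_ne_zero).symm

theorem radialSet_congr_ae (w : ℂ) {S S' : Set ℝ} (h : S =ᵐ[volume] S') :
    radialSet w S =ᵐ[volume] radialSet w S' :=
  (measurePreserving_centred w).quasiMeasurePreserving.preimage_ae_eq (ae_restrict_of_ae h)

theorem volume_radialSet (w : ℂ) {S : Set ℝ} (hS : MeasurableSet S) (hpos : S ⊆ Ioi 0) :
    volume (radialSet w S) = volume S := by
  refine ((measurePreserving_centred w).measure_preimage hS.nullMeasurableSet).trans ?_
  rw [Measure.restrict_apply hS, inter_eq_left.2 hpos]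

theorem setIntegral_Ioo_poissonWeight (k : ℕ) {a : ℝ} (ha : 0 ≤ a) :
    ∫ s in Ioo 0 a, poissonWeight k s = poissonTail k a := by
  rw [← integral_Ioc_eq_integral_Ioo, ← intervalIntegral.integral_of_le ha,
    intervalIntegral_poissonWeight]

theorem eigenvalue_of_ae_eq_ball {Ω : Set ℂ} (hΩ : NullMeasurableSet Ω volume) {c : ℂ} {r : ℝ}
    (hr : 0 < r) (h : Ω =ᵐ[volume] Metric.ball c r) (k : ℕ) :
    eigenvalue Ω hΩ (k + 1) = poissonTail k (Real.pi * r ^ 2) := by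
  have ha : 0 ≤ Real.pi * r ^ 2 := by positivity
  have hd := isDiagonal_toeplitz hΩ measurableSet_Ioo Ioo_subset_Ioi_self
    (h.trans (ball_ae_eq_radialSet c hr))
  simp_rw [setIntegral_Ioo_poissonWeight _ ha] at hd
  exact hd.nthEigenvalue_eq (isGreedy_id (poissonTail_antitone ha)) k

theorem setIntegral_poissonWeight_pos (k : ℕ) {S : Set ℝ} (hS : MeasurableSet S)
    (hpos : S ⊆ Ioi 0) (hfin : volume S ≠ ∞) (hS0 : 0 < volume S) :
    0 < ∫ s in S, poissonWeight k s := by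
  rw [setIntegral_pos_iff_support_of_nonneg_ae ?_ (integrableOn_poissonWeight k hS hpos hfin)]
  · have h : S ⊆ Function.support (poissonWeight k) :=
      fun s hs => (poissonWeight_pos k (hpos hs)).ne'
    rwa [inter_eq_right.2 h]
  · filter_upwards [ae_restrict_mem hS] with s hs
    exact (poissonWeight_pos k (hpos hs)).le

/-- Dominated convergence applies, the weights being at most $1$ on a set of finite measure.
Together with positivity this lets the eigenvalues be listed greedily. -/
theorem tendsto_setIntegral_poissonWeight {S : Set ℝ} (hS : MeasurableSet S)
    (hpos : S ⊆ Ioi 0) (hfin : volume S ≠ ∞) :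
    Tendsto (fun k => ∫ s in S, poissonWeight k s) atTop (𝓝 0) := by
  have h := tendsto_integral_of_dominated_convergence (μ := volume.restrict S)
    (F := poissonWeight) (f := fun _ => 0) (fun _ => (1 : ℝ))
    (fun k => (continuous_poissonWeight k).aestronglyMeasurable)
    (integrableOn_const hfin) (fun k => ?_)
    (Eventually.of_forall tendsto_poissonWeight_index)
  · simpa using h
  · filter_upwards [ae_restrict_mem hS] with s hs
    have h0 : 0 ≤ s := le_of_lt (hpos hs)
    rw [Real.norm_of_nonneg (poissonWeight_nonneg k h0)]
    exact poissonWeight_le_one k h0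

/-! ### The weighted inequality and its equality case -/

/-- Summation by parts against decreasing weights. -/
theorem mul_sum_le_sum_mul {t d : ℕ → ℝ} {n : ℕ} (hn : 1 ≤ n)
    (hmono : ∀ k ∈ Finset.Ico 1 n, t (k + 1) ≤ t k)
    (hd : ∀ m, 0 ≤ ∑ k ∈ Finset.Icc 1 m, d k) :
    t n * ∑ k ∈ Finset.Icc 1 n, d k ≤ ∑ k ∈ Finset.Icc 1 n, t k * d k := by
  induction n, hn using Nat.le_induction with
  | base => simp
  | succ n hn ih =>
    have h1 := ih fun k hk => hmono k (Finset.Ico_subset_Ico_right n.le_succ hk)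
    have h2 := hmono n (by simp; omega)
    rw [Finset.sum_Icc_succ_top (by omega), Finset.sum_Icc_succ_top (by omega)]
    -- Replacing the weight $t_n$ by the smaller $t_{n+1}$ on the nonnegative partial sum can only
    -- lower the bound.
    have h3 := mul_nonneg (sub_nonneg.2 h2) (hd n)
    linarith

theorem sum_Icc_one_eq_sum_range (f : ℕ → ℝ) (m : ℕ) :
    ∑ k ∈ Finset.Icc 1 m, f k = ∑ i ∈ Finset.range m, f (i + 1) := by
  induction m with
  | zero => simp
  | succ m ih => rw [Finset.sum_Icc_succ_top (by omega), Finset.sum_range_succ, ih]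

theorem image_add_right_ball (c w : ℂ) (r : ℝ) :
    (fun z => z + w) '' Metric.ball c r = Metric.ball (c + w) r := by
  simp

end FockSpace

end

theorem corollary3p2
    (Ω : Set ℂ) (hΩ : NullMeasurableSet Ω volume)
    (hsym : FockSpace.IsCircularlySymmetric Ω)
    (hpos : 0 < volume Ω) (hfin : volume Ω < ∞)
    (c : ℂ) (r : ℝ) (hvol : volume (Metric.ball c r) = volume Ω)
    (n : ℕ) (hn : 2 ≤ n) (t : ℕ → ℝ)
    (hmono : ∀ k ∈ Finset.Ico 1 n, t (k + 1) ≤ t k) (htn : 0 < t n) :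
    (∑ k ∈ Finset.Icc 1 n, t k * FockSpace.eigenvalue Ω hΩ k ≤
      ∑ k ∈ Finset.Icc 1 n, t k *
        FockSpace.eigenvalue (Metric.ball c r) measurableSet_ball.nullMeasurableSet k) ∧
    ((∑ k ∈ Finset.Icc 1 n, t k * FockSpace.eigenvalue Ω hΩ k =
      ∑ k ∈ Finset.Icc 1 n, t k *
        FockSpace.eigenvalue (Metric.ball c r) measurableSet_ball.nullMeasurableSet k) ↔
      ∃ w : ℂ, FockSpace.Equivalent Ω ((fun z => z + w) '' Metric.ball c r)) := by
  obtain ⟨w, S, hS, hS0, hΩS⟩ := hsym.exists_radialSet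
  have hr : 0 < r := by
    by_contra! h
    rw [Metric.ball_eq_empty.2 h, measure_empty] at hvol
    exact hpos.ne hvol
  have hvS : volume Ω = volume S := by
    rw [measure_congr hΩS, FockSpace.volume_radialSet w hS hS0]
  have hSfin : volume S ≠ ∞ := hvS ▸ hfin.ne
  have hSa : volume.real S = Real.pi * r ^ 2 := by
    rw [measureReal_def, ← hvS, ← hvol, measure_congr (FockSpace.ball_ae_eq_radialSet c hr),
      FockSpace.volume_radialSet c measurableSet_Ioo Ioo_subset_Ioi_self, Real.volume_Ioo,
      sub_zero, ENNReal.toReal_ofReal (by positivity)]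
  obtain ⟨σ, hσ⟩ := FockSpace.exists_isGreedy
    (fun k => FockSpace.setIntegral_poissonWeight_pos k hS hS0 hSfin (hvS ▸ hpos))
    (FockSpace.tendsto_setIntegral_poissonWeight hS hS0 hSfin)
  have hlam : ∀ k, FockSpace.eigenvalue Ω hΩ (k + 1) =
      ∫ s in S, FockSpace.poissonWeight (σ k) s :=
    (FockSpace.isDiagonal_toeplitz hΩ hS hS0 hΩS).nthEigenvalue_eq hσ
  have hdisc := FockSpace.eigenvalue_of_ae_eq_ball
    (measurableSet_ball (x := c) (ε := r)).nullMeasurableSet hr ae_eq_rfl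
  have hsumΩ : ∀ m, ∑ k ∈ Finset.Icc 1 m, FockSpace.eigenvalue Ω hΩ k =
      ∑ k ∈ (Finset.range m).image σ, ∫ s in S, FockSpace.poissonWeight k s := by
    intro m
    rw [FockSpace.sum_Icc_one_eq_sum_range, Finset.sum_image hσ.injective.injOn]
    exact Finset.sum_congr rfl fun k _ => hlam k
  have hsumD : ∀ m, ∑ k ∈ Finset.Icc 1 m, FockSpace.eigenvalue (Metric.ball c r)
      measurableSet_ball.nullMeasurableSet k =
      FockSpace.tailSum ((Finset.range m).image σ).card (volume.real S) := by
    intro m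
    rw [FockSpace.sum_Icc_one_eq_sum_range, Finset.card_image_of_injective _ hσ.injective,
      Finset.card_range, hSa]
    exact Finset.sum_congr rfl fun k _ => hdisc k
  -- The set $K$ consists of the first $m$ greedy picks; injectivity of $\sigma$ gives it exactly
  -- $m$ elements.
  have hcomp := fun m => FockSpace.sum_integral_poissonWeight_le hS hS0 hSfin
    ((Finset.range m).image σ)
  have habel := FockSpace.mul_sum_le_sum_mul (t := t) (n := n)
    (d := fun k => FockSpace.eigenvalue (Metric.ball c r) measurableSet_ball.nullMeasurableSet k -
      FockSpace.eigenvalue Ω hΩ k) (by omega) hmono fun m => by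
      rw [Finset.sum_sub_distrib, hsumΩ, hsumD]
      exact sub_nonneg.2 (hcomp m).1
  simp only [mul_sub, Finset.sum_sub_distrib] at habel
  rw [← mul_sub, hsumΩ, hsumD] at habel
  have hDn := mul_nonneg htn.le (sub_nonneg.2 (hcomp n).1)
  refine ⟨by linarith, fun heq => ?_, ?_⟩
  · have h1 : t n * (FockSpace.tailSum ((Finset.range n).image σ).card (volume.real S) -
        ∑ k ∈ (Finset.range n).image σ, ∫ s in S, FockSpace.poissonWeight k s) = 0 := by
      linarith
    have h2 := (sub_eq_zero.1 ((mul_eq_zero.1 h1).resolve_left htn.ne')).symm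
    have h3 := (hcomp n).2 (Finset.image_nonempty.2 (Finset.nonempty_range_iff.2 (by omega))) h2
    -- The translation by $w-c$ carries the centre of the given disc to the centre of symmetry of
    -- $\Omega$.
    refine ⟨w - c, measure_symmDiff_eq_zero_iff.2 ?_⟩
    rw [FockSpace.image_add_right_ball, add_sub_cancel]
    rw [hSa] at h3
    exact hΩS.trans ((FockSpace.radialSet_congr_ae w (h3.trans Ioo_ae_eq_Ioc.symm)).trans
      (FockSpace.ball_ae_eq_radialSet w hr).symm)
  · rintro ⟨v, hv⟩
    rw [FockSpace.Equivalent, FockSpace.image_add_right_ball] at hv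
    have h1 := FockSpace.eigenvalue_of_ae_eq_ball hΩ hr (measure_symmDiff_eq_zero_iff.1 hv)
    refine Finset.sum_congr rfl fun k hk => ?_
    obtain ⟨i, rfl⟩ := Nat.exists_eq_add_of_le' (Finset.mem_Icc.1 hk).1
    rw [h1, hdisc]
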